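/- Let $R\in\mathbb{C}[t]$ be a polynomial of degree $3$ or $4$ with simple roots, and call *roots of $R$ on $\mathbb{P}^1(\mathbb{C})=\mathbb{C}\cup\{\infty\}$* its roots in $\mathbb{C}$ together with $\infty$ if $\deg R=3$. Let $S\in\mathrm{PGL}_2(\mathbb{C})$ be a Möbius involution ($S^2=\mathrm{id}$, $S\ne\mathrm{id}$) that permutes the four roots of $R$ on $\mathbb{P}^1(\mathbb{C})$ in pairs, i.e. maps this set to itself and fixes none of its elements. Let $F\in\mathbb{C}(t)$ satisfy $F(t)+F(S(t))=0$ identically. Then $\int F(t)\,dt/\sqrt{R(t)}$ is pseudo-elliptic: the element $F/\sqrt R$ of the differential field $\mathbb{C}(t,\sqrt R)$ (with derivation $d/dt$) has an antiderivative in an elementary extension, that is, in a differential field extension obtained by finitely many adjunctions $K_{i+1}=K_i(\theta_i)$ in which $\theta_i$ is algebraic over $K_i$, or an exponential ($\theta_i\neq 0$, $\theta_i'/\theta_i\in K_i$), or a logarithm ($\theta_i'=\eta'/\eta$ with $0\ne\eta\in K_i$). Moreover $S$ has exactly two fixed points in $\mathbb{P}^1(\mathbb{C})$. If $\alpha,\beta$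 are these two points, in either order, and $$u=\frac{t-\alpha}{t-\beta},\qquad x=u^2$$ (a factor $t-\infty$ being read as $1$), then there are $G\in\mathbb{C}(x)$ and a quadratic polynomial $Q\in\mathbb{C}[x]$ with two distinct roots such that, under this substitution and for a suitable choice of $\sqrt{Q(x)}$ in $\mathbb{C}(t,\sqrt R)$, $$\frac{F(t)\,dt}{\sqrt{R(t)}}=\frac{G(x)\,dx}{2\sqrt{Q(x)}},\qquad\text{hence}\qquad \int F(t)\,\frac{dt}{\sqrt{R(t)}}=\int\frac{G(x)\,dx}{2\sqrt{Q(x)}},$$ and the latter integral is elementary, i.e. $G/(2\sqrt Q)\in\mathbb{C}(x,\sqrt Q)$ (with derivation $d/dx$) has an antiderivative in an elementary extension of $\mathbb{C}(x,\sqrt Q)$. -/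

import Mathlib

open scoped Differential OnePoint Polynomial MatrixGroups

noncomputable section

namespace Goursat

/-! ### The differential field `ℂ(t)` -/

/-- The derivative `d/dt` of a rational function, by the quotient rule. -/
def ratDeriv (f : RatFunc ℂ) : RatFunc ℂ :=
  (algebraMap ℂ[X] (RatFunc ℂ) (Polynomial.derivative f.num) * algebraMap ℂ[X] (RatFunc ℂ) f.denom
    - algebraMap ℂ[X] (RatFunc ℂ) f.num
      * algebraMap ℂ[X] (RatFunc ℂ) (Polynomial.derivative f.denom))
    / (algebraMap ℂ[X] (RatFunc ℂ) f.denom) ^ 2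

theorem algebraMap_ne_zero' {q : ℂ[X]} (hq : q ≠ 0) : algebraMap ℂ[X] (RatFunc ℂ) q ≠ 0 :=
  RatFunc.algebraMap_ne_zero hq

theorem ratDeriv_div (p q : ℂ[X]) (hq : q ≠ 0) :
    ratDeriv (algebraMap ℂ[X] (RatFunc ℂ) p / algebraMap ℂ[X] (RatFunc ℂ) q) =
      (algebraMap ℂ[X] (RatFunc ℂ) (Polynomial.derivative p) * algebraMap ℂ[X] (RatFunc ℂ) q
        - algebraMap ℂ[X] (RatFunc ℂ) p * algebraMap ℂ[X] (RatFunc ℂ) (Polynomial.derivative q))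
        / (algebraMap ℂ[X] (RatFunc ℂ) q) ^ 2 := by
  set f : RatFunc ℂ := algebraMap ℂ[X] (RatFunc ℂ) p / algebraMap ℂ[X] (RatFunc ℂ) q with hf
  have hd : f.denom ≠ 0 := f.denom_ne_zero
  have hq' := algebraMap_ne_zero' hq
  have hd' := algebraMap_ne_zero' hd
  have h1 : algebraMap ℂ[X] (RatFunc ℂ) f.num * algebraMap ℂ[X] (RatFunc ℂ) q
      = algebraMap ℂ[X] (RatFunc ℂ) p * algebraMap ℂ[X] (RatFunc ℂ) f.denom := by
    have h := f.num_div_denom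
    rw [div_eq_iff hd'] at h
    rw [h, hf]
    field_simp
  have h2 : f.num * q = p * f.denom := by
    apply RatFunc.algebraMap_injective ℂ
    simpa using h1
  have h3 := congrArg (fun r => algebraMap ℂ[X] (RatFunc ℂ) (Polynomial.derivative r)) h2
  simp only [Polynomial.derivative_mul, map_add, map_mul] at h3
  unfold ratDeriv
  rw [div_eq_div_iff (pow_ne_zero 2 hd') (pow_ne_zero 2 hq')]
  linear_combination (algebraMap ℂ[X] (RatFunc ℂ) q * algebraMap ℂ[X] (RatFunc ℂ) f.denom) * h3
    - (algebraMap ℂ[X] (RatFunc ℂ) f.denom * algebraMap ℂ[X] (RatFunc ℂ) (Polynomial.derivative q)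
      + algebraMap ℂ[X] (RatFunc ℂ) q
        * algebraMap ℂ[X] (RatFunc ℂ) (Polynomial.derivative f.denom)) * h1

theorem exists_div (f : RatFunc ℂ) : ∃ p q : ℂ[X], q ≠ 0 ∧
    f = algebraMap ℂ[X] (RatFunc ℂ) p / algebraMap ℂ[X] (RatFunc ℂ) q :=
  ⟨f.num, f.denom, f.denom_ne_zero, f.num_div_denom.symm⟩

theorem ratDeriv_add (f g : RatFunc ℂ) : ratDeriv (f + g) = ratDeriv f + ratDeriv g := by
  obtain ⟨p, q, hq, rfl⟩ := exists_div f
  obtain ⟨r, s, hs, rfl⟩ := exists_div g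
  have hq' := algebraMap_ne_zero' hq
  have hs' := algebraMap_ne_zero' hs
  rw [div_add_div _ _ hq' hs', ← map_mul, ← map_mul, ← map_add, ← map_mul,
    ratDeriv_div _ _ (mul_ne_zero hq hs), ratDeriv_div _ _ hq, ratDeriv_div _ _ hs]
  simp only [Polynomial.derivative_mul, map_add, map_mul]
  field_simp
  ring

theorem ratDeriv_mul (f g : RatFunc ℂ) : ratDeriv (f * g) = f * ratDeriv g + g * ratDeriv f := by
  obtain ⟨p, q, hq, rfl⟩ := exists_div f
  obtain ⟨r, s, hs, rfl⟩ := exists_div g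
  have hq' := algebraMap_ne_zero' hq
  have hs' := algebraMap_ne_zero' hs
  rw [div_mul_div_comm, ← map_mul, ← map_mul,
    ratDeriv_div _ _ (mul_ne_zero hq hs), ratDeriv_div _ _ hq, ratDeriv_div _ _ hs]
  simp only [Polynomial.derivative_mul, map_add, map_mul]
  field_simp
  ring

/-- A map that is additive and satisfies the Leibniz rule, as a derivation. -/
@[reducible]
def mkDifferential {K : Type*} [CommRing K] (D : K → K) (hadd : ∀ a b, D (a + b) = D a + D b)
    (hmul : ∀ a b, D (a * b) = a * D b + b * D a) : Differential K where
  deriv := Derivation.mk' (AddMonoidHom.mk' D hadd).toIntLinearMap (fun a b => hmul a b)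

/-- `ℂ(t)` is a differential field with the derivation `d/dt`. -/
instance ratFuncDifferential : Differential (RatFunc ℂ) :=
  mkDifferential ratDeriv ratDeriv_add ratDeriv_mul

/-! ### Elementary extensions and elementary integrals -/

section Elementary

universe u

variable (K L : Type u) [Field K] [Field L] [Differential L] [Algebra K L]

/-- `θ` is algebraic over `E`, or an exponential over `E`, or a logarithm over `E`. -/
def IsElementaryGenerator {K L : Type u} [Field K] [Field L] [Differential L] [Algebra K L]
    (E : IntermediateField K L) (θ : L) : Prop :=
  IsAlgebraic E θ ∨ (θ ≠ 0 ∧ θ′ / θ ∈ E) ∨ (∃ η ∈ E, η ≠ 0 ∧ θ′ = η′ / η)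

/-- The fields that are the top of a finite tower `K = K₀ ⊆ K₁ ⊆ ⋯ ⊆ Kₙ` inside `L` with
`Kᵢ₊₁ = Kᵢ(θᵢ)`, each `θᵢ` being algebraic, an exponential or a logarithm over `Kᵢ`. -/
inductive IsElementaryTower : IntermediateField K L → Prop
  | base : IsElementaryTower ⊥
  | step (E : IntermediateField K L) (θ : L) (hE : IsElementaryTower E)
      (hθ : IsElementaryGenerator E θ) :
      IsElementaryTower (E ⊔ IntermediateField.adjoin K {θ})

/-- The differential field extension `L / K` is elementary. -/
def IsElementaryExtension : Prop := IsElementaryTower K L ⊤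

/-- `f ∈ K` has an antiderivative in some elementary differential field extension of `K`. -/
def HasElementaryIntegral {K : Type u} [Field K] [CharZero K] [Differential K] (f : K) : Prop :=
  ∃ (L : Type u) (_ : Field L) (_ : Differential L) (_ : Algebra K L)
    (_ : DifferentialAlgebra K L),
    IsElementaryExtension K L ∧ ∃ g : L, g′ = algebraMap K L f

end Elementary

/-! ### The differential field `ℂ(t, √P)` -/

/-- A square root of the polynomial `P` in the algebraic closure of `ℂ(t)`. -/
def sqrtClosure (P : ℂ[X]) : AlgebraicClosure (RatFunc ℂ) :=
  (IsAlgClosed.exists_pow_nat_eq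
    (algebraMap (RatFunc ℂ) (AlgebraicClosure (RatFunc ℂ)) (algebraMap ℂ[X] (RatFunc ℂ) P))
    two_pos).choose

/-- The field `ℂ(t, √P)`. -/
abbrev SqrtField (P : ℂ[X]) : IntermediateField (RatFunc ℂ) (AlgebraicClosure (RatFunc ℂ)) :=
  IntermediateField.adjoin (RatFunc ℂ) {sqrtClosure P}

/-- `ℂ(t, √P)` is finite over `ℂ(t)`, so Mathlib equips it with the unique derivation that
extends `d/dt`. -/
instance sqrtFieldFinite (P : ℂ[X]) : FiniteDimensional (RatFunc ℂ) (SqrtField P) :=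
  IntermediateField.adjoin.finiteDimensional
    (Algebra.IsIntegral.isIntegral (R := RatFunc ℂ) (sqrtClosure P))

/-- The element `√P` of `ℂ(t, √P)`. -/
def sqrtOf (P : ℂ[X]) : SqrtField P :=
  ⟨sqrtClosure P, IntermediateField.mem_adjoin_simple_self _ _⟩

theorem sqrtOf_sq (P : ℂ[X]) :
    sqrtOf P ^ 2 = algebraMap (RatFunc ℂ) (SqrtField P) (algebraMap ℂ[X] (RatFunc ℂ) P) :=
  Subtype.ext (IsAlgClosed.exists_pow_nat_eq
    (algebraMap (RatFunc ℂ) (AlgebraicClosure (RatFunc ℂ)) (algebraMap ℂ[X] (RatFunc ℂ) P))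
    two_pos).choose_spec

/-- The integral `∫ F(t) dt / √(R(t))` is elementary. -/
def IsPseudoElliptic (R : ℂ[X]) (F : RatFunc ℂ) : Prop :=
  HasElementaryIntegral (algebraMap (RatFunc ℂ) (SqrtField R) F / sqrtOf R)

/-! ### Möbius involutions

A Möbius transformation is represented by an invertible matrix, acting on
`ℙ¹(ℂ) = OnePoint ℂ` by `z ↦ (A z + B) / (C z + D)`. -/

/-- The class of `S` in `PGL₂(ℂ)`, the quotient of `GL₂(ℂ)` by its centre, has order two. -/
def IsMobiusInvolution (S : GL (Fin 2) ℂ) : Prop :=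
  S ^ 2 ∈ Subgroup.center (GL (Fin 2) ℂ) ∧ S ∉ Subgroup.center (GL (Fin 2) ℂ)

/-- The roots of `R` on the projective line; a cubic has `∞` as its fourth root. -/
def projRoots (R : ℂ[X]) : Set (OnePoint ℂ) :=
  {z | (∃ a : ℂ, z = (a : OnePoint ℂ) ∧ R.IsRoot a) ∨ (z = ∞ ∧ R.natDegree = 3)}

/-- `S` maps the set of roots to itself and fixes none of them, so that an involution `S`
permutes the roots in pairs. -/
def PermutesInPairs (S : GL (Fin 2) ℂ) (R : ℂ[X]) : Prop :=
  ∀ z ∈ projRoots R, S • z ∈ projRoots R ∧ S • z ≠ z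

/-- The rational function `S(t) = (A t + B) / (C t + D)`. -/
def mobiusFun (S : GL (Fin 2) ℂ) : RatFunc ℂ :=
  (RatFunc.C (S 0 0) * RatFunc.X + RatFunc.C (S 0 1)) /
    (RatFunc.C (S 1 0) * RatFunc.X + RatFunc.C (S 1 1))

/-- The rational function `F(S(t))`. -/
def compMobius (F : RatFunc ℂ) (S : GL (Fin 2) ℂ) : RatFunc ℂ :=
  RatFunc.eval RatFunc.C (mobiusFun S) F

/-- The factor `t - a`, read as `1` for `a = ∞`. -/
def linFactor : OnePoint ℂ → RatFunc ℂ
  | ∞ => 1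
  | (a : ℂ) => RatFunc.X - RatFunc.C a

/-- The coordinate `u = (t - α) / (t - β)`; it is `t - α` for `β = ∞`, and `1 / (t - β)` for
`α = ∞`. -/
def fixCoord (α β : OnePoint ℂ) : RatFunc ℂ := linFactor α / linFactor β

end Goursat

end

/-! The coordinate u sends the fixed points α, β of S to 0 and ∞, so S becomes u ↦ -u
(`map_fixCoord`). The four roots of R then have coordinates ±p and ±q with p² ≠ q², and du/dt is a
constant over the square of the linear factor at β. Hence (du/dt)² R = Q(u²) with Q quadratic and
separable (`exists_quadratic`). Since ℂ(t) = ℂ(u) and F is odd under S, F = b(u²) u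
(`exists_eq_eval_mul_fixCoord`). With x = u² and dx = 2u du, this gives F dt/√R = b(x) dx/(2√Q(x)).

The conic η² = Q(x) is rational: for a root a of Q, the function s = η/(x - a) generates both x and
η over ℂ. The integrand becomes g(s) ds, and partial fractions turn it into w' + ∑ cᵢ vᵢ'/vᵢ
(`sqrt_quadratic_mem_liouvilleSpan`), which is integrated by adjoining a logarithm of each vᵢ
(`hasElementaryIntegral_of_logDeriv_sum`). This second half only needs x and η in a differential
field whose constants contain ℂ, so it serves for ℂ(t, √R) and for ℂ(x, √Q) alike.

Points of ℙ¹ are handled through homogeneous coordinates and 2×2 determinants, which spares most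
case distinctions at ∞. -/

noncomputable section

namespace Goursat

/-! ### Adjoining a primitive -/

section Primitive

universe u

variable {K : Type u} [Field K]

/-- The extension to `K(X)` of a derivation of `K[X]`, by the quotient rule. -/
def quotDeriv (D : Derivation ℤ K[X] K[X]) (f : RatFunc K) : RatFunc K :=
  (algebraMap K[X] (RatFunc K) (D f.num) * algebraMap K[X] (RatFunc K) f.denom
    - algebraMap K[X] (RatFunc K) f.num * algebraMap K[X] (RatFunc K) (D f.denom))
    / (algebraMap K[X] (RatFunc K) f.denom) ^ 2

/-- Independence of the representing fraction: apply D to the cross-multiplied identity `f.num * q =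
p * f.denom`. -/
theorem quotDeriv_div (D : Derivation ℤ K[X] K[X]) (p q : K[X]) (hq : q ≠ 0) :
    quotDeriv D (algebraMap K[X] (RatFunc K) p / algebraMap K[X] (RatFunc K) q) =
      (algebraMap K[X] (RatFunc K) (D p) * algebraMap K[X] (RatFunc K) q
        - algebraMap K[X] (RatFunc K) p * algebraMap K[X] (RatFunc K) (D q))
        / (algebraMap K[X] (RatFunc K) q) ^ 2 := by
  set f : RatFunc K := algebraMap K[X] (RatFunc K) p / algebraMap K[X] (RatFunc K) q with hf
  have hq' := RatFunc.algebraMap_ne_zero hq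
  have hd' := RatFunc.algebraMap_ne_zero f.denom_ne_zero
  have h1 : algebraMap K[X] (RatFunc K) f.num * algebraMap K[X] (RatFunc K) q
      = algebraMap K[X] (RatFunc K) p * algebraMap K[X] (RatFunc K) f.denom := by
    have h := f.num_div_denom
    rw [div_eq_iff hd'] at h
    rw [h, hf]
    field_simp
  have h2 : f.num * q = p * f.denom := by
    apply RatFunc.algebraMap_injective K
    simpa using h1
  have h3 := congrArg (fun r => algebraMap K[X] (RatFunc K) (D r)) h2
  simp only [Derivation.leibniz, smul_eq_mul, map_add, map_mul] at h3
  unfold quotDeriv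
  rw [div_eq_div_iff (pow_ne_zero 2 hd') (pow_ne_zero 2 hq')]
  linear_combination (algebraMap K[X] (RatFunc K) q * algebraMap K[X] (RatFunc K) f.denom) * h3
    - (algebraMap K[X] (RatFunc K) f.denom * algebraMap K[X] (RatFunc K) (D q)
      + algebraMap K[X] (RatFunc K) q * algebraMap K[X] (RatFunc K) (D f.denom)) * h1

theorem quotDeriv_algebraMap (D : Derivation ℤ K[X] K[X]) (p : K[X]) :
    quotDeriv D (algebraMap K[X] (RatFunc K) p) = algebraMap K[X] (RatFunc K) (D p) := by
  have h := quotDeriv_div D p 1 one_ne_zero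
  simpa using h

theorem exists_algebraMap_div (f : RatFunc K) : ∃ p q : K[X], q ≠ 0 ∧
    f = algebraMap K[X] (RatFunc K) p / algebraMap K[X] (RatFunc K) q :=
  ⟨f.num, f.denom, f.denom_ne_zero, f.num_div_denom.symm⟩

theorem quotDeriv_add (D : Derivation ℤ K[X] K[X]) (f g : RatFunc K) :
    quotDeriv D (f + g) = quotDeriv D f + quotDeriv D g := by
  obtain ⟨p, q, hq, rfl⟩ := exists_algebraMap_div f
  obtain ⟨r, s, hs, rfl⟩ := exists_algebraMap_div g
  have hq' := RatFunc.algebraMap_ne_zero hq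
  have hs' := RatFunc.algebraMap_ne_zero hs
  rw [div_add_div _ _ hq' hs', ← map_mul, ← map_mul, ← map_add, ← map_mul,
    quotDeriv_div _ _ _ (mul_ne_zero hq hs), quotDeriv_div _ _ _ hq, quotDeriv_div _ _ _ hs]
  simp only [Derivation.leibniz, smul_eq_mul, map_add, map_mul]
  field_simp
  ring

theorem quotDeriv_mul (D : Derivation ℤ K[X] K[X]) (f g : RatFunc K) :
    quotDeriv D (f * g) = f * quotDeriv D g + g * quotDeriv D f := by
  obtain ⟨p, q, hq, rfl⟩ := exists_algebraMap_div f
  obtain ⟨r, s, hs, rfl⟩ := exists_algebraMap_div g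
  have hq' := RatFunc.algebraMap_ne_zero hq
  have hs' := RatFunc.algebraMap_ne_zero hs
  rw [div_mul_div_comm, ← map_mul, ← map_mul,
    quotDeriv_div _ _ _ (mul_ne_zero hq hs), quotDeriv_div _ _ _ hq, quotDeriv_div _ _ _ hs]
  simp only [Derivation.leibniz, smul_eq_mul, map_add, map_mul]
  field_simp
  ring

/-- Every element `d` of a differential field `K` has a primitive `θ` in a differential field
extension that `θ` generates over `K`. -/
theorem exists_adjoin_primitive [Differential K] (d : K) :
    ∃ (L : Type u) (_ : Field L) (_ : Differential L) (_ : Algebra K L)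
      (_ : DifferentialAlgebra K L) (θ : L),
      θ′ = algebraMap K L d ∧ IntermediateField.adjoin K {θ} = ⊤ := by
  -- The derivation of K[X] extending that of K with X' = d. The variable is transcendental even if
  -- d already has a primitive in K; elementary extensions may acquire new constants, so this is
  -- harmless.
  let D : Derivation ℤ K[X] K[X] := Differential.implicitDeriv (Polynomial.C d)
  let _ : Differential (RatFunc K) := mkDifferential (quotDeriv D) (quotDeriv_add D)
    (quotDeriv_mul D)
  have hder (f : RatFunc K) : f′ = quotDeriv D f := rfl
  refine ⟨RatFunc K, inferInstance, inferInstance, inferInstance, ⟨fun a => ?_⟩, RatFunc.X, ?_,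
    RatFunc.adjoin_X⟩
  · rw [hder, RatFunc.algebraMap_eq_C, ← RatFunc.algebraMap_C, quotDeriv_algebraMap,
      ← RatFunc.algebraMap_C]
    simp [D]
  · rw [hder, ← RatFunc.algebraMap_X, quotDeriv_algebraMap]
    simp [D]

end Primitive

/-! ### Integrals that are sums of logarithms -/

section Logarithms

universe u

open IntermediateField

/-- A tower over an extension generated by one elementary element is a tower over the base. -/
theorem IsElementaryTower.restrictScalars {K M L : Type u} [Field K] [Field M] [Field L]
    [Differential L] [Algebra K M] [Algebra M L] [Algebra K L] [IsScalarTower K M L] {θ : M}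
    (hθ : adjoin K {θ} = ⊤)
    (hgen : IsElementaryGenerator (⊥ : IntermediateField K L) (algebraMap M L θ))
    {E : IntermediateField M L} (hE : IsElementaryTower M L E) :
    IsElementaryTower K L (E.restrictScalars K) := by
  induction hE with
  | base =>
    -- The bottom field over M is the image of M = K(θ), which is one step above K.
    have h : (⊥ : IntermediateField M L).restrictScalars K = ⊥ ⊔ adjoin K {algebraMap M L θ} := by
      rw [bot_sup_eq]
      have h1 := congrArg (IntermediateField.map (IsScalarTower.toAlgHom K M L)) hθ
      rw [adjoin_map, Set.image_singleton] at h1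
      rw [IsScalarTower.coe_toAlgHom'] at h1
      rw [h1]
      ext y
      simp [IntermediateField.mem_bot]
    rw [h]
    exact .step _ _ .base hgen
  | step E ζ _ hζ ih =>
    have h : (E ⊔ adjoin M {ζ}).restrictScalars K = E.restrictScalars K ⊔ adjoin K {ζ} := by
      apply le_antisymm
      · have hM : ∀ m : M, algebraMap M L m ∈ E.restrictScalars K ⊔ adjoin K {ζ} := fun m =>
          (le_sup_left : E.restrictScalars K ≤ E.restrictScalars K ⊔ adjoin K {ζ})
            (E.algebraMap_mem m)
        let N : IntermediateField M L :=
          { (E.restrictScalars K ⊔ adjoin K {ζ}).toSubfield with algebraMap_mem' := hM }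
        have hN : E ⊔ adjoin M {ζ} ≤ N := by
          refine sup_le (fun y hy => ?_) ?_
          · exact (le_sup_left : E.restrictScalars K ≤ E.restrictScalars K ⊔ adjoin K {ζ}) hy
          · rw [adjoin_simple_le_iff]
            exact (le_sup_right : adjoin K {ζ} ≤ E.restrictScalars K ⊔ adjoin K {ζ})
              (mem_adjoin_simple_self K ζ)
        exact fun y hy => hN hy
      · refine sup_le (fun y hy => ?_) ?_
        · exact (le_sup_left : E ≤ E ⊔ adjoin M {ζ}) hy
        · rw [adjoin_simple_le_iff]
          exact (le_sup_right : adjoin M {ζ} ≤ E ⊔ adjoin M {ζ}) (mem_adjoin_simple_self M ζ)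
    rw [h]
    -- Being an elementary generator depends only on the underlying subfield of L, so `hζ` carries
    -- over.
    exact .step _ _ ih hζ

theorem hasElementaryIntegral_deriv {K : Type u} [Field K] [CharZero K] [Differential K] (w : K) :
    HasElementaryIntegral w′ := by
  refine ⟨K, inferInstance, inferInstance, inferInstance, inferInstance, ?_, w, rfl⟩
  have h : (⊤ : IntermediateField K K) = ⊥ := by
    ext y
    simp [IntermediateField.mem_bot]
  rw [IsElementaryExtension, h]
  exact .base

/-- A derivative plus a linear combination, with constant coefficients, of logarithmic
derivatives has an elementary integral. -/
theorem hasElementaryIntegral_of_logDeriv_sum {K : Type u} [Field K] [CharZero K] [Differential K]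
    (w : K) (l : List (K × K)) (hl : ∀ p ∈ l, p.1′ = 0 ∧ p.2 ≠ 0) :
    HasElementaryIntegral (w′ + (l.map fun p => p.1 * (p.2′ / p.2)).sum) := by
  -- The rest of the list is integrated over the larger field M = K(θ), so K must vary; the
  -- induction runs on the length because the type of the list changes.
  induction hn : l.length generalizing K with
  | zero =>
    rw [List.length_eq_zero_iff] at hn
    subst hn
    simpa using hasElementaryIntegral_deriv w
  | succ n ih =>
    obtain _ | ⟨⟨c, v⟩, l⟩ := l
    · simp at hn
    obtain ⟨M, _, _, _, _, θ, hθ, htop⟩ := exists_adjoin_primitive (v′ / v)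
    have : CharZero M := charZero_of_injective_algebraMap (algebraMap K M).injective
    have hcv := hl (c, v) (by simp)
    obtain ⟨L, _, _, _, _, hL, g, hg⟩ := ih (algebraMap K M w)
      (l.map fun p => (algebraMap K M p.1, algebraMap K M p.2))
      (by
        intro p hp
        obtain ⟨q, hq, rfl⟩ := List.mem_map.1 hp
        have h := hl q (by simp [hq])
        exact ⟨by simp [deriv_algebraMap, h.1], by simpa using h.2⟩)
      (by simpa using hn)
    let _ : Algebra K L := ((algebraMap M L).comp (algebraMap K M)).toAlgebra
    have : IsScalarTower K M L := IsScalarTower.of_algebraMap_eq' rfl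
    have hKL (a : K) : algebraMap K L a = algebraMap M L (algebraMap K M a) := rfl
    -- As c is constant, cθ is a primitive of c v'/v; g integrates the rest.
    refine ⟨L, inferInstance, inferInstance, inferInstance, ⟨fun a => ?_⟩, ?_,
      g + algebraMap M L (algebraMap K M c * θ), ?_⟩
    · simp [hKL, deriv_algebraMap]
    · have h := IsElementaryTower.restrictScalars htop (L := L) (.inr (.inr ⟨algebraMap K L v,
        IntermediateField.algebraMap_mem _ v, by simpa using hcv.2, ?_⟩)) hL
      · simpa [IsElementaryExtension] using h
      · rw [deriv_algebraMap, hθ, hKL]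
        simp [deriv_algebraMap]
    · have hsum : ((l.map fun p => (algebraMap K M p.1, algebraMap K M p.2)).map
          fun p => p.1 * (p.2′ / p.2)).sum
          = algebraMap K M (l.map fun p => p.1 * (p.2′ / p.2)).sum := by
        rw [map_list_sum, List.map_map, List.map_map]
        congr 1
        apply List.map_congr_left
        intro p _
        simp [deriv_algebraMap]
      rw [map_add, hg, hsum, deriv_algebraMap, deriv_algebraMap, Derivation.leibniz, hθ,
        deriv_algebraMap, hcv.1]
      simp [hKL]
      ring

/-- The elements `w' + ∑ cᵢ vᵢ' / vᵢ` with complex coefficients `cᵢ`. -/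
def liouvilleSpan (K : Type u) [Field K] [Differential K] [Algebra ℂ K] : Submodule ℂ K :=
  Submodule.span ℂ {f | (∃ w : K, f = w′) ∨ ∃ v : K, v ≠ 0 ∧ f = v′ / v}

/-- Complex scalars are constants, so they can be moved into w and into the coefficients: the sums
w' + ∑ cᵢ vᵢ'/vᵢ are closed under linear combinations. -/
theorem hasElementaryIntegral_of_mem_liouvilleSpan {K : Type u} [Field K] [CharZero K]
    [Differential K] [Algebra ℂ K] (hC : ∀ c : ℂ, (algebraMap ℂ K c)′ = 0) {f : K}
    (hf : f ∈ liouvilleSpan K) : HasElementaryIntegral f := by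
  suffices h : ∃ (w : K) (l : List (K × K)), (∀ p ∈ l, p.1′ = 0 ∧ p.2 ≠ 0) ∧
      f = w′ + (l.map fun p => p.1 * (p.2′ / p.2)).sum by
    obtain ⟨w, l, hl, rfl⟩ := h
    exact hasElementaryIntegral_of_logDeriv_sum w l hl
  induction hf using Submodule.span_induction with
  | mem f hf =>
    obtain ⟨w, rfl⟩ | ⟨v, hv, rfl⟩ := hf
    · exact ⟨w, [], by simp, by simp⟩
    · exact ⟨0, [(1, v)], by simp [hv], by simp⟩
  | zero => exact ⟨0, [], by simp, by simp⟩
  | add f g _ _ hf hg =>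
    obtain ⟨w, l, hl, rfl⟩ := hf
    obtain ⟨w', l', hl', rfl⟩ := hg
    refine ⟨w + w', l ++ l', fun p hp => ?_, ?_⟩
    · rcases List.mem_append.1 hp with h | h
      exacts [hl p h, hl' p h]
    · simp
      ring
  | smul c f _ hf =>
    obtain ⟨w, l, hl, rfl⟩ := hf
    refine ⟨algebraMap ℂ K c * w, l.map fun p => (algebraMap ℂ K c * p.1, p.2), fun p hp => ?_, ?_⟩
    · obtain ⟨q, hq, rfl⟩ := List.mem_map.1 hp
      have h := hl q hq
      exact ⟨by simp [h.1, hC], h.2⟩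
    · rw [Algebra.smul_def, mul_add, List.map_map, ← List.sum_map_mul_left]
      simp [hC, Function.comp_def, mul_assoc]

end Logarithms

/-! ### Partial fractions and the rationalization of a conic -/

section PartialFractions

open IntermediateField Polynomial

variable {K : Type} [Field K] [Algebra ℂ K]

/-- The span of the powers of `s` and of the negative powers of the `s - a`. -/
def simpleFractions (s : K) : Submodule ℂ K :=
  Submodule.span ℂ {g | (∃ n : ℕ, g = s ^ n) ∨
    ∃ (a : ℂ) (n : ℕ), g = ((s - algebraMap ℂ K a) ^ (n + 1))⁻¹}

theorem aeval_mem_simpleFractions (s : K) (p : ℂ[X]) : aeval s p ∈ simpleFractions s := by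
  rw [aeval_eq_sum_range]
  exact Submodule.sum_mem _ fun n _ => Submodule.smul_mem _ _ (Submodule.subset_span (.inl ⟨n, rfl⟩))

/-- For a ≠ b, the identity 1/((s-a)(s-b)) = (1/(s-a) - 1/(s-b))/(a-b) lowers the exponent of s - a
by one. -/
theorem inv_pow_mul_inv_mem_simpleFractions {s : K} (hs : ∀ a, s - algebraMap ℂ K a ≠ 0) (a b : ℂ)
    (n : ℕ) : ((s - algebraMap ℂ K a) ^ n)⁻¹ * (s - algebraMap ℂ K b)⁻¹ ∈ simpleFractions s := by
  induction n with
  | zero => exact Submodule.subset_span (.inr ⟨b, 0, by simp⟩)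
  | succ n ih =>
    obtain rfl | hab := eq_or_ne a b
    · refine Submodule.subset_span (.inr ⟨a, n + 1, ?_⟩)
      rw [pow_succ _ (n + 1), mul_inv]
    · have hab' : algebraMap ℂ K a - algebraMap ℂ K b ≠ 0 := by
        rw [← map_sub]
        simpa [sub_eq_zero] using hab
      have h : ((s - algebraMap ℂ K a) ^ (n + 1))⁻¹ * (s - algebraMap ℂ K b)⁻¹
          = (a - b)⁻¹ • (((s - algebraMap ℂ K a) ^ (n + 1))⁻¹
            - ((s - algebraMap ℂ K a) ^ n)⁻¹ * (s - algebraMap ℂ K b)⁻¹) := by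
        have ha := hs a
        have hb := hs b
        rw [Algebra.smul_def, map_inv₀, map_sub]
        field_simp
        ring
      rw [h]
      exact Submodule.smul_mem _ _ (Submodule.sub_mem _ (Submodule.subset_span (.inr ⟨a, n, rfl⟩)) ih)

theorem mul_inv_mem_simpleFractions {s : K} (hs : ∀ a, s - algebraMap ℂ K a ≠ 0) (b : ℂ) {g : K}
    (hg : g ∈ simpleFractions s) : g * (s - algebraMap ℂ K b)⁻¹ ∈ simpleFractions s := by
  induction hg using Submodule.span_induction with
  | mem g hg =>
    obtain ⟨n, rfl⟩ | ⟨a, n, rfl⟩ := hg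
    -- Division with remainder of Xⁿ by X - b.
    · have h := congrArg (aeval s) (modByMonic_add_div (X ^ n : ℂ[X]) (X - C b))
      rw [modByMonic_X_sub_C_eq_C_eval] at h
      simp only [map_add, map_mul, map_sub, aeval_C, aeval_X, map_pow] at h
      have hb := hs b
      have h2 : s ^ n * (s - algebraMap ℂ K b)⁻¹
          = (eval b (X ^ n : ℂ[X])) • ((s - algebraMap ℂ K b) ^ (0 + 1))⁻¹
            + aeval s ((X ^ n : ℂ[X]) /ₘ (X - C b)) := by
        rw [← h, Algebra.smul_def, zero_add, pow_one]
        field_simp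
      rw [h2]
      exact Submodule.add_mem _
        (Submodule.smul_mem _ _ (Submodule.subset_span (.inr ⟨b, 0, rfl⟩)))
        (aeval_mem_simpleFractions s _)
    · exact inv_pow_mul_inv_mem_simpleFractions hs a b (n + 1)
  | zero => simp
  | add f g _ _ hf hg => rw [add_mul]; exact Submodule.add_mem _ hf hg
  | smul c f _ hf => rw [smul_mul_assoc]; exact Submodule.smul_mem _ _ hf

/-- Partial fraction decomposition. -/
theorem mem_simpleFractions_of_mem_adjoin {s : K} (hs : ∀ a, s - algebraMap ℂ K a ≠ 0) {g : K}
    (hg : g ∈ adjoin ℂ {s}) : g ∈ simpleFractions s := by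
  obtain ⟨p, q, rfl⟩ := (mem_adjoin_simple_iff ℂ g).1 hg
  have hq := (IsAlgClosed.splits q).eq_prod_roots
  rw [hq, map_mul, aeval_C, map_multiset_prod, Multiset.map_map, div_mul_eq_div_div, div_eq_mul_inv]
  have hmain : ∀ m : Multiset ℂ, aeval s p / algebraMap ℂ K q.leadingCoeff *
      (m.map (aeval s ∘ fun a => X - C a)).prod⁻¹ ∈ simpleFractions s := by
    intro m
    induction m using Multiset.induction_on with
    | empty =>
      have h : aeval s p / algebraMap ℂ K q.leadingCoeff = (q.leadingCoeff)⁻¹ • aeval s p := by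
        rw [Algebra.smul_def, map_inv₀, div_eq_inv_mul]
      simpa [h] using Submodule.smul_mem _ _ (aeval_mem_simpleFractions s p)
    | cons a m ih =>
      have h := mul_inv_mem_simpleFractions hs a ih
      simpa [mul_assoc, mul_comm, mul_left_comm] using h
  exact hmain _

theorem ratFunc_eval_mem_adjoin (x : K) (G : RatFunc ℂ) :
    RatFunc.eval (algebraMap ℂ K) x G ∈ adjoin ℂ {x} :=
  (mem_adjoin_simple_iff ℂ _).2 ⟨G.num, G.denom, rfl⟩

variable [Differential K]

/-- Term by term in the partial fractions of g: a power of s or of s - a with exponent other than -1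
integrates to a power, and exponent -1 gives a logarithmic derivative. -/
theorem mul_deriv_mem_liouvilleSpan (hC : ∀ c : ℂ, (algebraMap ℂ K c)′ = 0) {s g : K}
    (hg : g ∈ adjoin ℂ {s}) : g * s′ ∈ liouvilleSpan K := by
  by_cases hs' : s′ = 0
  · simp [hs']
  -- Once s' ≠ 0, s is not a complex constant, so all its partial fractions make sense.
  have hs : ∀ a, s - algebraMap ℂ K a ≠ 0 := by
    intro a h
    rw [sub_eq_zero] at h
    exact hs' (by rw [h, hC])
  have : CharZero K := charZero_of_injective_algebraMap (algebraMap ℂ K).injective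
  have hn (n : ℕ) : ((n : K) + 1) ≠ 0 := Nat.cast_add_one_ne_zero n
  have hder {w : K} : w′ ∈ liouvilleSpan K := Submodule.subset_span (.inl ⟨w, rfl⟩)
  replace hg := mem_simpleFractions_of_mem_adjoin hs hg
  induction hg using Submodule.span_induction with
  | mem g hg =>
    obtain ⟨n, rfl⟩ | ⟨a, n, rfl⟩ := hg
    · have h : s ^ n * s′ = ((n : ℂ) + 1)⁻¹ • (s ^ (n + 1))′ := by
        rw [Algebra.smul_def, Derivation.leibniz_pow]
        simp
        field_simp [hn n]
      rw [h]
      exact Submodule.smul_mem _ _ hder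
    · have hsa : (s - algebraMap ℂ K a)′ = s′ := by rw [map_sub, hC, sub_zero]
      rcases n with _ | n
      · refine Submodule.subset_span (.inr ⟨_, hs a, ?_⟩)
        rw [hsa]
        simp [div_eq_inv_mul]
      · have h : ((s - algebraMap ℂ K a) ^ (n + 1 + 1))⁻¹ * s′
            = (-((n : ℂ) + 1)⁻¹) • (((s - algebraMap ℂ K a) ^ (n + 1))⁻¹)′ := by
          have ha := hs a
          rw [Algebra.smul_def, Derivation.leibniz_inv, Derivation.leibniz_pow, hsa]
          simp
          field_simp [hn n]
          ring
        rw [h]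
        exact Submodule.smul_mem _ _ hder
  | zero => simp
  | add f g _ _ hf hg => rw [add_mul]; exact Submodule.add_mem _ hf hg
  | smul c f _ hf => rw [smul_mul_assoc]; exact Submodule.smul_mem _ _ hf

/-- Chain rule: the y in ℂ(s) with y' in ℂ(s)·s' form a field containing ℂ and s. -/
theorem deriv_mem_adjoin_mul_deriv (hC : ∀ c : ℂ, (algebraMap ℂ K c)′ = 0) {s y : K}
    (hy : y ∈ adjoin ℂ {s}) : ∃ r ∈ adjoin ℂ {s}, y′ = r * s′ := by
  induction hy using adjoin_induction with
  | mem y hy =>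
    rw [Set.mem_singleton_iff] at hy
    exact ⟨1, one_mem _, by rw [hy, one_mul]⟩
  | algebraMap c => exact ⟨0, zero_mem _, by rw [hC, zero_mul]⟩
  | add y z _ _ hy hz =>
    obtain ⟨r, hr, hy⟩ := hy
    obtain ⟨t, ht, hz⟩ := hz
    exact ⟨r + t, add_mem hr ht, by rw [map_add, hy, hz, add_mul]⟩
  | inv y hy' hy =>
    obtain ⟨r, hr, hy⟩ := hy
    refine ⟨-(y⁻¹ ^ 2) * r, mul_mem (neg_mem (pow_mem (inv_mem hy') 2)) hr, ?_⟩
    rw [Derivation.leibniz_inv, hy]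
    simp [mul_assoc]
  | mul y z hy' hz' hy hz =>
    obtain ⟨r, hr, hy⟩ := hy
    obtain ⟨t, ht, hz⟩ := hz
    refine ⟨y * t + z * r, add_mem (mul_mem hy' ht) (mul_mem hz' hr), ?_⟩
    rw [Derivation.leibniz, hy, hz]
    simp
    ring

theorem exists_roots_of_natDegree_two {Q : ℂ[X]} (hdeg : Q.natDegree = 2) (hsep : Q.Separable) :
    ∃ c a b : ℂ, c ≠ 0 ∧ a ≠ b ∧ Q = C c * ((X - C a) * (X - C b)) := by
  have hQ := (IsAlgClosed.splits Q).eq_prod_roots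
  have hcard : Multiset.card Q.roots = 2 := by
    rw [← hdeg]
    exact (IsAlgClosed.splits Q).natDegree_eq_card_roots.symm
  obtain ⟨a, b, hab⟩ := Multiset.card_eq_two.1 hcard
  have hnd := nodup_roots hsep
  rw [hab] at hnd hQ
  refine ⟨Q.leadingCoeff, a, b, ?_, by simpa using hnd, by simpa using hQ⟩
  rw [leadingCoeff_ne_zero]
  rintro rfl
  simp at hdeg

/-- The integral of a rational function of `x` and of the square root `η` of a quadratic
polynomial in `x`: with `s = η / (x - a)` for a root `a`, both `x` and `η` lie in `ℂ(s)`. -/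
theorem sqrt_quadratic_mem_liouvilleSpan (hC : ∀ c : ℂ, (algebraMap ℂ K c)′ = 0) {Q : ℂ[X]}
    (hdeg : Q.natDegree = 2) (hsep : Q.Separable) {x η : K}
    (hη : η ^ 2 = Q.eval₂ (algebraMap ℂ K) x) (G : RatFunc ℂ) :
    RatFunc.eval (algebraMap ℂ K) x G * x′ / (2 * η) ∈ liouvilleSpan K := by
  by_cases hη0 : η = 0
  · simp [hη0]
  obtain ⟨c, a, b, hc, hab, rfl⟩ := exists_roots_of_natDegree_two hdeg hsep
  simp only [eval₂_mul, eval₂_sub, eval₂_C, eval₂_X] at hη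
  set c' := algebraMap ℂ K c with hc'
  set a' := algebraMap ℂ K a with ha'
  set b' := algebraMap ℂ K b with hb'
  have hxa : x - a' ≠ 0 := by
    intro h
    rw [h] at hη
    exact hη0 (by simpa using hη)
  have hab' : a' - b' ≠ 0 := by
    rw [ha', hb', ← map_sub]
    simpa [sub_eq_zero] using hab
  have hc0 : c' ≠ 0 := by simpa [hc'] using hc
  set s := η / (x - a') with hs
  -- Linear in x, hence solvable for x in ℂ(s): the coefficient s² - c cannot vanish because a ≠ b.
  have hs2 : s ^ 2 * (x - a') = c' * (x - b') := by
    rw [hs, div_pow, hη]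
    field_simp
  have hsc : s ^ 2 - c' ≠ 0 := by
    intro h
    have h2 : c' * (a' - b') = 0 := by linear_combination (x - a') * h - hs2
    exact mul_ne_zero hc0 hab' h2
  have hx : x = (s ^ 2 * a' - c' * b') / (s ^ 2 - c') := by
    rw [eq_div_iff hsc]
    linear_combination hs2
  have hsm : s ∈ adjoin ℂ {s} := mem_adjoin_simple_self ℂ s
  have hcm (z : ℂ) : algebraMap ℂ K z ∈ adjoin ℂ {s} := IntermediateField.algebraMap_mem _ z
  have hxm : x ∈ adjoin ℂ {s} := by
    rw [hx]
    exact div_mem (sub_mem (mul_mem (pow_mem hsm 2) (hcm a)) (mul_mem (hcm c) (hcm b)))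
      (sub_mem (pow_mem hsm 2) (hcm c))
  have hηm : η ∈ adjoin ℂ {s} := by
    have h : η = s * (x - a') := by rw [hs, div_mul_cancel₀ _ hxa]
    rw [h]
    exact mul_mem hsm (sub_mem hxm (hcm a))
  have hGm : RatFunc.eval (algebraMap ℂ K) x G ∈ adjoin ℂ {s} :=
    (adjoin_simple_le_iff.2 hxm) (ratFunc_eval_mem_adjoin x G)
  obtain ⟨r, hr, hxr⟩ := deriv_mem_adjoin_mul_deriv hC hxm
  have h2 : (2 : K) ∈ adjoin ℂ {s} := ofNat_mem _ 2
  have h := mul_deriv_mem_liouvilleSpan hC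
    (div_mem (mul_mem hGm hr) (mul_mem h2 hηm) :
      RatFunc.eval (algebraMap ℂ K) x G * r / (2 * η) ∈ adjoin ℂ {s})
  rw [hxr]
  convert h using 1
  ring

end PartialFractions

/-! ### Möbius involutions in homogeneous coordinates -/

/-- The first homogeneous coordinate. -/
def homX : OnePoint ℂ → ℂ
  | ∞ => 1
  | (a : ℂ) => a

/-- The second homogeneous coordinate. -/
def homY : OnePoint ℂ → ℂ
  | ∞ => 0
  | (_ : ℂ) => 1

@[simp] theorem homX_infty : homX ∞ = 1 := rfl
@[simp] theorem homX_coe (a : ℂ) : homX a = a := rfl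
@[simp] theorem homY_infty : homY ∞ = 0 := rfl
@[simp] theorem homY_coe (a : ℂ) : homY a = 1 := rfl
@[simp] theorem linFactor_infty : linFactor ∞ = 1 := rfl
@[simp] theorem linFactor_coe (a : ℂ) : linFactor a = RatFunc.X - RatFunc.C a := rfl

/-- The determinant of the homogeneous coordinates of two points. -/
def bracket (z w : OnePoint ℂ) : ℂ := homX z * homY w - homX w * homY z

theorem bracket_eq_zero_iff {z w : OnePoint ℂ} : bracket z w = 0 ↔ z = w := by
  constructor
  · intro h
    induction z using OnePoint.rec <;> induction w using OnePoint.rec <;>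
      simp_all [bracket, sub_eq_zero]
  · rintro rfl
    simp [bracket]

theorem hom_ne_zero (z : OnePoint ℂ) (h : homY z = 0) : homX z ≠ 0 := by
  induction z using OnePoint.rec <;> simp_all

theorem exists_hom_eq {p q : ℂ} (h : p ≠ 0 ∨ q ≠ 0) :
    ∃ (z : OnePoint ℂ) (k : ℂ), k ≠ 0 ∧ p = k * homX z ∧ q = k * homY z := by
  by_cases hq : q = 0
  · exact ⟨∞, p, by simpa [hq] using h, by simp, by simp [hq]⟩
  · exact ⟨((p / q : ℂ) : OnePoint ℂ), q, hq, by simp [mul_div_cancel₀ _ hq], by simp⟩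

/-- The homogeneous form is -1 at ∞, where the linear factor is 1. The sign ε absorbs this and
disappears on squaring. -/
theorem linFactor_eq (z : OnePoint ℂ) : ∃ ε : ℂ, ε ^ 2 = 1 ∧
    linFactor z = RatFunc.C ε * (RatFunc.C (homY z) * RatFunc.X - RatFunc.C (homX z)) := by
  induction z using OnePoint.rec with
  | infty => exact ⟨-1, by simp, by simp⟩
  | coe a => exact ⟨1, by simp, by simp⟩

theorem linFactor_ne_zero (z : OnePoint ℂ) : linFactor z ≠ 0 := by
  induction z using OnePoint.rec with
  | infty => simp
  | coe a =>
    rw [linFactor_coe, ← RatFunc.algebraMap_X, ← RatFunc.algebraMap_C, ← map_sub]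
    exact RatFunc.algebraMap_ne_zero (Polynomial.X_sub_C_ne_zero a)

theorem det_ne_zero (S : GL (Fin 2) ℂ) : S 0 0 * S 1 1 - S 0 1 * S 1 0 ≠ 0 := by
  have h := S.det_ne_zero
  rwa [Matrix.det_fin_two] at h

/-- Lifts the action on ℙ¹ to the linear action on coordinate vectors, up to a scalar, with no
exceptional case at ∞. -/
theorem exists_hom_smul (S : GL (Fin 2) ℂ) (z : OnePoint ℂ) : ∃ k : ℂ, k ≠ 0 ∧
    S 0 0 * homX z + S 0 1 * homY z = k * homX (S • z) ∧
    S 1 0 * homX z + S 1 1 * homY z = k * homY (S • z) := by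
  have hdet := det_ne_zero S
  induction z using OnePoint.rec with
  | infty =>
    rw [OnePoint.smul_infty_eq_ite]
    split_ifs with h
    · refine ⟨S 0 0, ?_, by simp, by simp [h]⟩
      rintro h0
      simp [h, h0] at hdet
    · exact ⟨S 1 0, h, by simp [mul_div_cancel₀ _ h], by simp⟩
  | coe a =>
    rw [OnePoint.smul_some_eq_ite]
    split_ifs with h
    · refine ⟨S 0 0 * a + S 0 1, ?_, by simp, by simp [h]⟩
      intro h0
      have h2 : S 0 0 * S 1 1 - S 0 1 * S 1 0 = 0 := by
        linear_combination S 0 0 * h - S 1 0 * h0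
      exact hdet h2
    · exact ⟨S 1 0 * a + S 1 1, h, by simp [mul_div_cancel₀ _ h], by simp⟩

/-- The homogeneous coordinates of `z` form an eigenvector of `S` for the eigenvalue `k`. -/
def IsEigenpoint (S : GL (Fin 2) ℂ) (z : OnePoint ℂ) (k : ℂ) : Prop :=
  S 0 0 * homX z + S 0 1 * homY z = k * homX z ∧ S 1 0 * homX z + S 1 1 * homY z = k * homY z

theorem IsEigenpoint.smul_eq {S : GL (Fin 2) ℂ} {z : OnePoint ℂ} {k : ℂ}
    (h : IsEigenpoint S z k) : S • z = z := by
  obtain ⟨m, hm, h1, h2⟩ := exists_hom_smul S z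
  rw [← bracket_eq_zero_iff]
  have h3 : m * bracket (S • z) z = 0 := by
    unfold bracket
    linear_combination homY z * (h.1 - h1) - homX z * (h.2 - h2)
  exact (mul_eq_zero.1 h3).resolve_left hm

theorem exists_isEigenpoint {S : GL (Fin 2) ℂ} {z : OnePoint ℂ} (h : S • z = z) :
    ∃ k : ℂ, k ≠ 0 ∧ IsEigenpoint S z k := by
  obtain ⟨k, hk, h1, h2⟩ := exists_hom_smul S z
  rw [h] at h1 h2
  exact ⟨k, hk, h1, h2⟩

/-- The trace vanishes. As S² is scalar, trace times each off-diagonal entry, and trace times the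
difference of the diagonal entries, are zero; a nonzero trace would make S itself scalar. -/
theorem IsMobiusInvolution.apply_one_one {S : GL (Fin 2) ℂ} (hS : IsMobiusInvolution S) :
    S 1 1 = -S 0 0 := by
  obtain ⟨h2, h1⟩ := hS
  rw [Matrix.GeneralLinearGroup.mem_center_iff_val_mem_range_scalar] at h1 h2
  obtain ⟨c, hc⟩ := h2
  have h00 := congrFun (congrFun hc 0) 0
  have h01 := congrFun (congrFun hc 0) 1
  have h10 := congrFun (congrFun hc 1) 0
  have h11 := congrFun (congrFun hc 1) 1
  simp [pow_two, Matrix.mul_apply, Fin.sum_univ_two] at h00 h01 h10 h11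
  by_contra hne
  have htr : S 0 0 + S 1 1 ≠ 0 := fun h => hne (by linear_combination h)
  have hb : S 0 1 = 0 := by
    have : S 0 1 * (S 0 0 + S 1 1) = 0 := by linear_combination -h01
    exact (mul_eq_zero.1 this).resolve_right htr
  have hc' : S 1 0 = 0 := by
    have : S 1 0 * (S 0 0 + S 1 1) = 0 := by linear_combination -h10
    exact (mul_eq_zero.1 this).resolve_right htr
  have had : S 0 0 = S 1 1 := by
    have : (S 0 0 - S 1 1) * (S 0 0 + S 1 1) = 0 := by linear_combination h11 - h00
    exact sub_eq_zero.1 ((mul_eq_zero.1 this).resolve_right htr)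
  refine h1 ⟨S 0 0, ?_⟩
  ext i j
  fin_cases i <;> fin_cases j <;> simp [hb, hc', had]

/-- From det(Sz, w) + det(z, Sw) = tr(S) det(z, w). -/
theorem IsEigenpoint.sum_eq_trace {S : GL (Fin 2) ℂ} {z w : OnePoint ℂ} {k m : ℂ}
    (hz : IsEigenpoint S z k) (hw : IsEigenpoint S w m) (h : z ≠ w) :
    k + m = S 0 0 + S 1 1 := by
  have hb : bracket z w ≠ 0 := fun h0 => h (bracket_eq_zero_iff.1 h0)
  apply mul_right_cancel₀ hb
  unfold bracket
  linear_combination (-homY w) * hz.1 + homX w * hz.2 + homY z * hw.1 - homX z * hw.2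

/-- Cayley–Hamilton for trace zero: S² is the scalar -det S. -/
theorem IsEigenpoint.sq_eq {S : GL (Fin 2) ℂ} {z : OnePoint ℂ} {k : ℂ} (hz : IsEigenpoint S z k)
    (htr : S 1 1 = -S 0 0) : k ^ 2 = S 0 0 ^ 2 + S 0 1 * S 1 0 := by
  obtain ⟨h1, h2⟩ := hz
  rw [htr] at h2
  by_cases hy : homY z = 0
  · apply mul_right_cancel₀ (hom_ne_zero z hy)
    linear_combination (-k - S 0 0) * h1 - S 0 1 * h2
  · apply mul_right_cancel₀ hy
    linear_combination (-S 1 0) * h1 + (S 0 0 - k) * h2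

/-- Since (S - k)(S + k) = 0, the columns of S + k are eigenvectors for k or zero; both vanish only
if k = 0. -/
theorem exists_isEigenpoint_of_sq_eq {S : GL (Fin 2) ℂ} (htr : S 1 1 = -S 0 0) {k : ℂ}
    (hk : k ≠ 0) (hk2 : k ^ 2 = S 0 0 ^ 2 + S 0 1 * S 1 0) : ∃ z, IsEigenpoint S z k := by
  by_cases h : S 0 0 + k ≠ 0 ∨ S 1 0 ≠ 0
  · obtain ⟨z, m, hm, h1, h2⟩ := exists_hom_eq h
    refine ⟨z, mul_left_cancel₀ hm ?_, mul_left_cancel₀ hm ?_⟩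
    · linear_combination (k - S 0 0) * h1 - S 0 1 * h2 - hk2
    · rw [htr]
      linear_combination (-S 1 0) * h1 + (k + S 0 0) * h2
  · push Not at h
    have h' : S 0 1 ≠ 0 ∨ k - S 0 0 ≠ 0 := by
      right
      intro h0
      exact hk (by linear_combination (h.1 + h0) / 2)
    obtain ⟨z, m, hm, h1, h2⟩ := exists_hom_eq h'
    refine ⟨z, mul_left_cancel₀ hm ?_, mul_left_cancel₀ hm ?_⟩
    · linear_combination (k - S 0 0) * h1 - S 0 1 * h2
    · rw [htr]
      linear_combination (-S 1 0) * h1 + (k + S 0 0) * h2 - hk2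

/-- The eigenvalues are ±k with k² = -det S ≠ 0. Each has a single eigenpoint, since two of them
would make the trace 2m ≠ 0. -/
theorem IsMobiusInvolution.exists_fixedPoints {S : GL (Fin 2) ℂ} (hS : IsMobiusInvolution S) :
    ∃ α β : OnePoint ℂ, α ≠ β ∧ {z : OnePoint ℂ | S • z = z} = {α, β} := by
  have htr := hS.apply_one_one
  obtain ⟨k, hk⟩ := IsAlgClosed.exists_pow_nat_eq (S 0 0 ^ 2 + S 0 1 * S 1 0) two_pos
  have hk0 : k ≠ 0 := by
    rintro rfl
    apply det_ne_zero S
    rw [htr]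
    linear_combination hk
  obtain ⟨α, hα⟩ := exists_isEigenpoint_of_sq_eq htr hk0 hk
  obtain ⟨β, hβ⟩ := exists_isEigenpoint_of_sq_eq htr (neg_ne_zero.2 hk0) (by rw [neg_sq, hk])
  have huniq : ∀ {z w : OnePoint ℂ} {m : ℂ}, m ≠ 0 → IsEigenpoint S z m → IsEigenpoint S w m →
      z = w := by
    intro z w m hm hz hw
    by_contra hne
    have h := hz.sum_eq_trace hw hne
    rw [htr] at h
    exact hm (by linear_combination h / 2)
  refine ⟨α, β, ?_, ?_⟩
  · rintro rfl
    have hx : k * homX α = 0 := by linear_combination (hβ.1 - hα.1) / 2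
    have hy : k * homY α = 0 := by linear_combination (hβ.2 - hα.2) / 2
    exact hom_ne_zero α ((mul_eq_zero.1 hy).resolve_left hk0) ((mul_eq_zero.1 hx).resolve_left hk0)
  · ext z
    simp only [Set.mem_ofPred_eq, Set.mem_insert_iff, Set.mem_singleton_iff]
    constructor
    · intro hz
      obtain ⟨m, hm, hzm⟩ := exists_isEigenpoint hz
      have h := hzm.sq_eq htr
      rw [← hk, sq_eq_sq_iff_eq_or_eq_neg] at h
      rcases h with rfl | rfl
      · exact .inl (huniq hm hzm hα)
      · exact .inr (huniq hm hzm hβ)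
    · rintro (rfl | rfl)
      exacts [hα.smul_eq, hβ.smul_eq]

theorem IsMobiusInvolution.smul_smul {S : GL (Fin 2) ℂ} (hS : IsMobiusInvolution S)
    (z : OnePoint ℂ) : S • S • z = z := by
  have htr := hS.apply_one_one
  obtain ⟨k, hk, h1, h2⟩ := exists_hom_smul S z
  obtain ⟨m, hm, h3, h4⟩ := exists_hom_smul S (S • z)
  rw [htr] at h2 h4
  rw [← bracket_eq_zero_iff]
  have h : k * m * bracket (S • S • z) z = 0 := by
    unfold bracket
    linear_combination (homX z * k) * h4 - (homY z * k) * h3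
      + (homX z * S 1 0 - homY z * S 0 0) * h1 - (homX z * S 0 0 + homY z * S 0 1) * h2
  exact (mul_eq_zero.1 h).resolve_left (mul_ne_zero hk hm)

/-- Two distinct fixed points belong to opposite eigenvalues. -/
theorem IsMobiusInvolution.exists_eigenvalue {S : GL (Fin 2) ℂ} (hS : IsMobiusInvolution S)
    {α β : OnePoint ℂ} (hαβ : α ≠ β) (hα : S • α = α) (hβ : S • β = β) :
    ∃ k : ℂ, k ≠ 0 ∧ IsEigenpoint S α k ∧ IsEigenpoint S β (-k) := by
  obtain ⟨k, hk, hαk⟩ := exists_isEigenpoint hα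
  obtain ⟨m, hm, hβm⟩ := exists_isEigenpoint hβ
  have h := hαk.sum_eq_trace hβm hαβ
  rw [hS.apply_one_one] at h
  have hm' : m = -k := by linear_combination h
  exact ⟨k, hk, hαk, hm' ▸ hβm⟩

/-! ### The coordinate `u` and the quadratic polynomial `Q` -/

theorem deriv_C (c : ℂ) : (RatFunc.C c : RatFunc ℂ)′ = 0 := by
  have h := ratDeriv_div (Polynomial.C c) 1 one_ne_zero
  change ratDeriv _ = 0
  simpa using h

theorem deriv_X : (RatFunc.X : RatFunc ℂ)′ = 1 := by
  have h := ratDeriv_div Polynomial.X 1 one_ne_zero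
  change ratDeriv _ = 1
  simpa using h

theorem deriv_algebraMap_complex (P : ℂ[X]) (c : ℂ) : (algebraMap ℂ (SqrtField P) c)′ = 0 := by
  rw [IsScalarTower.algebraMap_apply ℂ (RatFunc ℂ) (SqrtField P), deriv_algebraMap,
    RatFunc.algebraMap_eq_C, deriv_C, map_zero]

theorem ratFunc_C_ne_zero {c : ℂ} (hc : c ≠ 0) : (RatFunc.C c : RatFunc ℂ) ≠ 0 := by
  simpa using hc

theorem deriv_div {K : Type*} [Field K] [Differential K] (a b : K) :
    (a / b)′ = (b * a′ - a * b′) / b ^ 2 := by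
  rw [Derivation.leibniz_div, div_eq_inv_mul]
  simp

/-- The derivative of the coordinate `u`. -/
theorem exists_deriv_fixCoord {α β : OnePoint ℂ} (hαβ : α ≠ β) :
    ∃ k : ℂ, k ≠ 0 ∧ (fixCoord α β)′ * linFactor β ^ 2 = RatFunc.C k := by
  have hβ0 := linFactor_ne_zero β
  rw [fixCoord, deriv_div]
  induction α using OnePoint.rec with
  | infty =>
    induction β using OnePoint.rec with
    | infty => exact absurd rfl hαβ
    | coe b =>
      refine ⟨-1, by simp, ?_⟩
      rw [linFactor_coe] at *
      simp [deriv_C, deriv_X]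
      field_simp
  | coe a =>
    induction β using OnePoint.rec with
    | infty => exact ⟨1, one_ne_zero, by simp [deriv_C, deriv_X]⟩
    | coe b =>
      refine ⟨a - b, sub_ne_zero.2 fun h => hαβ (by rw [h]), ?_⟩
      rw [linFactor_coe] at *
      simp [deriv_C, deriv_X]
      field_simp

theorem fixCoord_sq (α β : OnePoint ℂ) : fixCoord α β ^ 2 =
    ((RatFunc.C (homY α) * RatFunc.X - RatFunc.C (homX α)) /
      (RatFunc.C (homY β) * RatFunc.X - RatFunc.C (homX β))) ^ 2 := by
  obtain ⟨ε, hε, h1⟩ := linFactor_eq α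
  obtain ⟨δ, hδ, h2⟩ := linFactor_eq β
  rw [fixCoord, h1, h2, mul_div_mul_comm, mul_pow, div_pow, ← map_pow, ← map_pow, hε, hδ]
  simp

/-- The value at `z` of the square of the coordinate `u`. -/
def sqValue (α β z : OnePoint ℂ) : ℂ := (bracket α z / bracket z β) ^ 2

/-- The product of the linear factors of two points exchanged by `S`, in terms of `u`. -/
theorem exists_linFactor_mul_linFactor_smul {S : GL (Fin 2) ℂ} {α β : OnePoint ℂ} {k : ℂ}
    (hαβ : α ≠ β) (hk : k ≠ 0) (hα : IsEigenpoint S α k) (hβ : IsEigenpoint S β (-k))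
    {z : OnePoint ℂ} (hz : z ≠ β) :
    ∃ c : ℂ, c ≠ 0 ∧ linFactor z * linFactor (S • z) =
      RatFunc.C c * (fixCoord α β ^ 2 - RatFunc.C (sqValue α β z)) * linFactor β ^ 2 := by
  have hd : bracket α β ≠ 0 := mt bracket_eq_zero_iff.1 hαβ
  have hp : bracket z β ≠ 0 := mt bracket_eq_zero_iff.1 hz
  obtain ⟨m, hm, h1, h2⟩ := exists_hom_smul S z
  obtain ⟨ε, hε, e1⟩ := linFactor_eq z
  obtain ⟨δ, hδ, e2⟩ := linFactor_eq (S • z)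
  obtain ⟨ζ, hζ, e3⟩ := linFactor_eq β
  have hβ0 := linFactor_ne_zero β
  have hε0 : ε ≠ 0 := by rintro rfl; simp at hε
  have hδ0 : δ ≠ 0 := by rintro rfl; simp at hδ
  -- Cramer's rule expands z in the eigenbasis α, β; applying S then multiplies the two components
  -- by k and -k.
  have hx : homX z * bracket α β = bracket z β * homX α + bracket α z * homX β := by
    unfold bracket; ring
  have hy : homY z * bracket α β = bracket z β * homY α + bracket α z * homY β := by
    unfold bracket; ring
  have hSx : m * homX (S • z) * bracket α β
      = k * (bracket z β * homX α - bracket α z * homX β) := by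
    linear_combination (-bracket α β) * h1 + S 0 0 * hx + S 0 1 * hy
      + bracket z β * hα.1 + bracket α z * hβ.1
  have hSy : m * homY (S • z) * bracket α β
      = k * (bracket z β * homY α - bracket α z * homY β) := by
    linear_combination (-bracket α β) * h2 + S 1 0 * hx + S 1 1 * hy
      + bracket z β * hα.2 + bracket α z * hβ.2
  refine ⟨ε * δ * (k * bracket z β ^ 2 / (m * bracket α β ^ 2)), by positivity, ?_⟩
  have hβ0' : RatFunc.C (homY β) * RatFunc.X - RatFunc.C (homX β) ≠ 0 := by
    intro h
    rw [h, mul_zero] at e3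
    exact hβ0 e3
  have h3 : linFactor β ^ 2 = (RatFunc.C (homY β) * RatFunc.X - RatFunc.C (homX β)) ^ 2 := by
    rw [e3, mul_pow, ← map_pow, hζ, map_one, one_mul]
  rw [e1, e2, h3, fixCoord_sq, sqValue]
  have hd' := ratFunc_C_ne_zero hd
  have hp' := ratFunc_C_ne_zero hp
  have hm' := ratFunc_C_ne_zero hm
  replace hx := congrArg (RatFunc.C (K := ℂ)) hx
  replace hy := congrArg (RatFunc.C (K := ℂ)) hy
  replace hSx := congrArg (RatFunc.C (K := ℂ)) hSx
  replace hSy := congrArg (RatFunc.C (K := ℂ)) hSy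
  simp only [map_mul, map_add, map_sub] at hx hy hSx hSy
  simp only [map_mul, map_div₀, map_pow]
  -- The linear forms of z and S • z are proportional to the sum and the difference of the same
  -- multiples of those of α and β, so their product is a difference of squares.
  have g1 : RatFunc.C (bracket α β) * (RatFunc.C (homY z) * RatFunc.X - RatFunc.C (homX z))
      = RatFunc.C (bracket z β) * (RatFunc.C (homY α) * RatFunc.X - RatFunc.C (homX α))
        + RatFunc.C (bracket α z) * (RatFunc.C (homY β) * RatFunc.X - RatFunc.C (homX β)) := by
    linear_combination RatFunc.X * hy - hx
  have g2 : RatFunc.C m * RatFunc.C (bracket α β) *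
      (RatFunc.C (homY (S • z)) * RatFunc.X - RatFunc.C (homX (S • z)))
      = RatFunc.C k * (RatFunc.C (bracket z β) *
          (RatFunc.C (homY α) * RatFunc.X - RatFunc.C (homX α))
        - RatFunc.C (bracket α z) * (RatFunc.C (homY β) * RatFunc.X - RatFunc.C (homX β))) := by
    linear_combination RatFunc.X * hSy - hSx
  generalize RatFunc.C (homY z) * RatFunc.X - RatFunc.C (homX z) = P1 at *
  generalize RatFunc.C (homY (S • z)) * RatFunc.X - RatFunc.C (homX (S • z)) = P2 at *
  generalize RatFunc.C (homY α) * RatFunc.X - RatFunc.C (homX α) = Pα at *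
  generalize RatFunc.C (homY β) * RatFunc.X - RatFunc.C (homX β) = Pβ at *
  field_simp
  linear_combination (RatFunc.C ε * RatFunc.C δ * RatFunc.C m * RatFunc.C (bracket α β) * P2) * g1
    + RatFunc.C ε * RatFunc.C δ * (RatFunc.C (bracket z β) * Pα + RatFunc.C (bracket α z) * Pβ) * g2

/-- Equal squares mean that the u-coordinates of z and w agree up to sign, and S changes that sign;
so x = u² separates the orbits of S. This makes the two roots of Q distinct. -/
theorem eq_or_eq_smul_of_sqValue_eq {S : GL (Fin 2) ℂ} {α β : OnePoint ℂ} {k : ℂ}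
    (hαβ : α ≠ β) (hα : IsEigenpoint S α k) (hβ : IsEigenpoint S β (-k))
    {z w : OnePoint ℂ} (hz : z ≠ β) (hw : w ≠ β) (h : sqValue α β z = sqValue α β w) :
    w = z ∨ w = S • z := by
  have hd : bracket α β ≠ 0 := mt bracket_eq_zero_iff.1 hαβ
  have hp : bracket z β ≠ 0 := mt bracket_eq_zero_iff.1 hz
  have hq : bracket w β ≠ 0 := mt bracket_eq_zero_iff.1 hw
  rw [sqValue, sqValue, sq_eq_sq_iff_eq_or_eq_neg] at h
  rcases h with h | h
  · left
    rw [div_eq_div_iff hp hq] at h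
    rw [← bracket_eq_zero_iff]
    refine (mul_eq_zero.1 (?_ : bracket α β * bracket w z = 0)).resolve_left hd
    unfold bracket at *
    linear_combination h
  · right
    obtain ⟨m, hm, h1, h2⟩ := exists_hom_smul S z
    rw [← neg_div, div_eq_div_iff hp hq] at h
    rw [← bracket_eq_zero_iff]
    have hx : homX z * bracket α β = bracket z β * homX α + bracket α z * homX β := by
      unfold bracket; ring
    have hy : homY z * bracket α β = bracket z β * homY α + bracket α z * homY β := by
      unfold bracket; ring
    have hSx : m * homX (S • z) * bracket α β
        = k * (bracket z β * homX α - bracket α z * homX β) := by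
      linear_combination (-bracket α β) * h1 + S 0 0 * hx + S 0 1 * hy
        + bracket z β * hα.1 + bracket α z * hβ.1
    have hSy : m * homY (S • z) * bracket α β
        = k * (bracket z β * homY α - bracket α z * homY β) := by
      linear_combination (-bracket α β) * h2 + S 1 0 * hx + S 1 1 * hy
        + bracket z β * hα.2 + bracket α z * hβ.2
    have h3 : bracket w β * bracket α z + bracket z β * bracket α w = 0 := by
      linear_combination h
    refine (mul_eq_zero.1 (?_ : m * bracket α β * bracket w (S • z) = 0)).resolve_left
      (mul_ne_zero hm hd)
    have h4 : bracket w (S • z) = homX w * homY (S • z) - homX (S • z) * homY w := rfl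
    rw [h4]
    have h5 : bracket w β = homX w * homY β - homX β * homY w := rfl
    have h6 : bracket α w = homX α * homY w - homX w * homY α := rfl
    linear_combination homX w * hSy - homY w * hSx - k * h3 + k * bracket α z * h5
      + k * bracket z β * h6

/-- The roots of `R` on the projective line. -/
theorem exists_roots_finset {R : ℂ[X]} (hdeg : R.natDegree = 3 ∨ R.natDegree = 4)
    (hR : R.Separable) : ∃ P : Finset (OnePoint ℂ), P.card = 4 ∧ (∀ z, z ∈ P ↔ z ∈ projRoots R) ∧
      algebraMap ℂ[X] (RatFunc ℂ) R = RatFunc.C R.leadingCoeff * ∏ z ∈ P, linFactor z := by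
  classical
  have hR0 : R ≠ 0 := hR.ne_zero
  have hsplit := IsAlgClosed.splits R
  have hnd := Polynomial.nodup_roots hR
  have hroot (a : ℂ) : a ∈ R.roots.toFinset ↔ R.IsRoot a := by
    rw [Multiset.mem_toFinset, Polynomial.mem_roots hR0]
  have hinj : Function.Injective (fun a : ℂ => (a : OnePoint ℂ)) := OnePoint.coe_injective
  let P₀ : Finset (OnePoint ℂ) := Finset.image (fun a : ℂ => (a : OnePoint ℂ)) R.roots.toFinset
  have hcard : P₀.card = R.natDegree := by
    rw [Finset.card_image_of_injective _ hinj, Multiset.toFinset_card_of_nodup hnd,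
      ← hsplit.natDegree_eq_card_roots]
  have hprod : algebraMap ℂ[X] (RatFunc ℂ) R =
      RatFunc.C R.leadingCoeff * ∏ z ∈ P₀, linFactor z := by
    have h : ∏ z ∈ P₀, linFactor z = ∏ a ∈ R.roots.toFinset, linFactor a :=
      Finset.prod_image hinj.injOn
    have h2 : (R.roots.map fun a => Polynomial.X - Polynomial.C a).prod
        = ∏ a ∈ R.roots.toFinset, (Polynomial.X - Polynomial.C a) := by
      rw [Finset.prod, Multiset.toFinset_val, Multiset.dedup_eq_self.2 hnd]
    conv_lhs => rw [hsplit.eq_prod_roots, h2]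
    rw [map_mul, map_prod, h, RatFunc.algebraMap_C]
    simp
  have hmem (a : ℂ) : (a : OnePoint ℂ) ∈ P₀ ↔ R.IsRoot a := by
    rw [← hroot]
    exact hinj.mem_finset_image
  have hinf : ∞ ∉ P₀ := by simp [P₀]
  rcases hdeg with h | h
  -- For a cubic the fourth root ∞ contributes the factor 1.
  · refine ⟨insert ∞ P₀, by rw [Finset.card_insert_of_notMem hinf, hcard, h], fun z => ?_, ?_⟩
    · induction z using OnePoint.rec with
      | infty => simp [projRoots, h]
      | coe a => simp [projRoots, hmem]
    · rw [Finset.prod_insert hinf, linFactor_infty, one_mul, hprod]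
  · refine ⟨P₀, by rw [hcard, h], fun z => ?_, hprod⟩
    induction z using OnePoint.rec with
    | infty => simp [projRoots, h, hinf]
    | coe a => simp [projRoots, hmem]

/-- The roots of `R` are two pairs exchanged by `S`. -/
theorem exists_pairs {R : ℂ[X]} (hdeg : R.natDegree = 3 ∨ R.natDegree = 4) (hR : R.Separable)
    {S : GL (Fin 2) ℂ} (hS : IsMobiusInvolution S) (hSR : PermutesInPairs S R) :
    ∃ z w : OnePoint ℂ, S • z ≠ z ∧ S • w ≠ w ∧ w ≠ z ∧ w ≠ S • z ∧
      algebraMap ℂ[X] (RatFunc ℂ) R = RatFunc.C R.leadingCoeff *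
        ((linFactor z * linFactor (S • z)) * (linFactor w * linFactor (S • w))) := by
  classical
  obtain ⟨P, hcard, hmem, hprod⟩ := exists_roots_finset hdeg hR
  have hP (z : OnePoint ℂ) (hz : z ∈ P) : S • z ∈ P ∧ S • z ≠ z := by
    rw [hmem] at hz ⊢
    exact hSR z hz
  obtain ⟨z, hz⟩ : P.Nonempty := Finset.card_pos.1 (by omega)
  obtain ⟨w, hwP, hw⟩ : ∃ w ∈ P, w ∉ ({z, S • z} : Finset (OnePoint ℂ)) := by
    apply Finset.exists_mem_notMem_of_card_lt_card
    exact Finset.card_le_two.trans_lt (by omega)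
  simp only [Finset.mem_insert, Finset.mem_singleton, not_or] at hw
  have h1 := (hP z hz).2
  have h2 := (hP w hwP).2
  have h3 : S • w ≠ z := fun h => hw.2 (by rw [← h, hS.smul_smul])
  have h4 : S • w ≠ S • z := fun h => hw.1 (by rw [← hS.smul_smul w, h, hS.smul_smul])
  have hn1 : z ∉ ({S • z, w, S • w} : Finset (OnePoint ℂ)) := by
    simp [h1.symm, Ne.symm hw.1, h3.symm]
  have hn2 : S • z ∉ ({w, S • w} : Finset (OnePoint ℂ)) := by
    simp only [Finset.mem_insert, Finset.mem_singleton, not_or]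
    exact ⟨Ne.symm hw.2, h4.symm⟩
  have hn3 : w ∉ ({S • w} : Finset (OnePoint ℂ)) := by simpa using h2.symm
  have heq : ({z, S • z, w, S • w} : Finset (OnePoint ℂ)) = P := by
    apply Finset.eq_of_subset_of_card_le
    · intro y hy
      simp only [Finset.mem_insert, Finset.mem_singleton] at hy
      rcases hy with rfl | rfl | rfl | rfl
      exacts [hz, (hP _ hz).1, hwP, (hP _ hwP).1]
    · rw [hcard, Finset.card_insert_of_notMem hn1, Finset.card_insert_of_notMem hn2,
        Finset.card_insert_of_notMem hn3, Finset.card_singleton]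
  refine ⟨z, w, h1, h2, hw.1, hw.2, ?_⟩
  rw [hprod, ← heq, Finset.prod_insert hn1, Finset.prod_insert hn2, Finset.prod_insert hn3,
    Finset.prod_singleton]
  ring

/-- In the coordinate `u`, the polynomial `R` becomes a quadratic polynomial in `u ^ 2`. -/
theorem exists_quadratic {R : ℂ[X]} (hdeg : R.natDegree = 3 ∨ R.natDegree = 4) (hR : R.Separable)
    {S : GL (Fin 2) ℂ} (hS : IsMobiusInvolution S) (hSR : PermutesInPairs S R)
    {α β : OnePoint ℂ} (hαβ : α ≠ β) (hα : S • α = α) (hβ : S • β = β) :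
    ∃ Q : ℂ[X], Q.natDegree = 2 ∧ Q.Separable ∧
      (fixCoord α β)′ ^ 2 * algebraMap ℂ[X] (RatFunc ℂ) R
        = Polynomial.aeval (fixCoord α β ^ 2) Q := by
  obtain ⟨k, hk, hαk, hβk⟩ := hS.exists_eigenvalue hαβ hα hβ
  obtain ⟨z, w, hz, hw, hwz, hwSz, hprod⟩ := exists_pairs hdeg hR hS hSR
  have hzβ : z ≠ β := by rintro rfl; exact hz hβ
  have hwβ : w ≠ β := by rintro rfl; exact hw hβ
  obtain ⟨c, hc, h1⟩ := exists_linFactor_mul_linFactor_smul hαβ hk hαk hβk hzβ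
  obtain ⟨d, hd, h2⟩ := exists_linFactor_mul_linFactor_smul hαβ hk hαk hβk hwβ
  obtain ⟨e, he, h3⟩ := exists_deriv_fixCoord hαβ
  have hne : sqValue α β z ≠ sqValue α β w := fun h =>
    (eq_or_eq_smul_of_sqValue_eq hαβ hαk hβk hzβ hwβ h).elim hwz hwSz
  have hlc : R.leadingCoeff ≠ 0 := Polynomial.leadingCoeff_ne_zero.2 hR.ne_zero
  have hm : e ^ 2 * R.leadingCoeff * c * d ≠ 0 := by positivity
  -- Each pair of roots contributes the square of the linear factor at β; the resulting fourth power
  -- combines with u'² into e².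
  refine ⟨Polynomial.C (e ^ 2 * R.leadingCoeff * c * d) *
    ((Polynomial.X - Polynomial.C (sqValue α β z)) *
      (Polynomial.X - Polynomial.C (sqValue α β w))), ?_, ?_, ?_⟩
  · rw [Polynomial.natDegree_C_mul hm, Polynomial.natDegree_mul (Polynomial.X_sub_C_ne_zero _)
      (Polynomial.X_sub_C_ne_zero _), Polynomial.natDegree_X_sub_C, Polynomial.natDegree_X_sub_C]
  · have hsep := (Polynomial.separable_X_sub_C (x := sqValue α β z)).mul
      (Polynomial.separable_X_sub_C (x := sqValue α β w))
      (Polynomial.isCoprime_X_sub_C_of_isUnit_sub (sub_ne_zero.2 hne).isUnit)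
    exact hsep.unit_mul (Polynomial.isUnit_C.2 hm.isUnit)
  · have hβ0 := linFactor_ne_zero β
    rw [hprod, h1, h2]
    simp only [map_mul, map_sub, map_pow, Polynomial.aeval_C, Polynomial.aeval_X,
      RatFunc.algebraMap_eq_C]
    rw [← h3]
    ring

/-! ### Rational functions that are odd in `u` -/

open IntermediateField

theorem mobiusFun_denom_ne_zero (S : GL (Fin 2) ℂ) :
    (RatFunc.C (S 1 0) * RatFunc.X + RatFunc.C (S 1 1) : RatFunc ℂ) ≠ 0 := by
  have h : (RatFunc.C (S 1 0) * RatFunc.X + RatFunc.C (S 1 1) : RatFunc ℂ)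
      = algebraMap ℂ[X] (RatFunc ℂ)
        (Polynomial.C (S 1 0) * Polynomial.X + Polynomial.C (S 1 1)) := by simp
  rw [h]
  refine RatFunc.algebraMap_ne_zero fun h0 => det_ne_zero S ?_
  have h1 := congrArg (Polynomial.coeff · 1) h0
  have h2 := congrArg (Polynomial.coeff · 0) h0
  simp at h1 h2
  rw [h1, h2]
  ring

/-- A constant S(t) would have proportional numerator and denominator, so determinant zero.
Transcendence makes substitution of S(t) a homomorphism on all of ℂ(t). -/
theorem transcendental_mobiusFun (S : GL (Fin 2) ℂ) : Transcendental ℂ (mobiusFun S) := by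
  apply RatFunc.transcendental_of_ne_C
  rintro ⟨c, hc⟩
  rw [mobiusFun, div_eq_iff (mobiusFun_denom_ne_zero S)] at hc
  have h : (Polynomial.C (S 0 0) * Polynomial.X + Polynomial.C (S 0 1) : ℂ[X])
      = Polynomial.C c * (Polynomial.C (S 1 0) * Polynomial.X + Polynomial.C (S 1 1)) := by
    apply RatFunc.algebraMap_injective ℂ
    simpa using hc
  have h1 := congrArg (Polynomial.coeff · 1) h
  have h2 := congrArg (Polynomial.coeff · 0) h
  simp at h1 h2
  apply det_ne_zero S
  rw [h1, h2]
  ring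

/-- The substitution of `S(t)` for `t`, as a homomorphism. -/
theorem exists_compMobius_algHom (S : GL (Fin 2) ℂ) :
    ∃ φ : RatFunc ℂ →ₐ[ℂ] RatFunc ℂ, ∀ F, φ F = compMobius F S := by
  have hinj : Function.Injective (Polynomial.aeval (R := ℂ) (mobiusFun S)) :=
    transcendental_iff_injective.1 (transcendental_mobiusFun S)
  refine ⟨RatFunc.liftAlgHom (Polynomial.aeval (mobiusFun S))
    (nonZeroDivisors_le_comap_nonZeroDivisors_of_injective _ hinj), fun F => ?_⟩
  rw [RatFunc.liftAlgHom_apply, compMobius, RatFunc.eval]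
  rfl

/-- Substituting S(t) into the form of a fixed point reproduces that form, up to its eigenvalue and
factors common to all fixed points. In the quotient u only the ratio -1 of the eigenvalues survives.
-/
theorem compMobius_homogeneous {S : GL (Fin 2) ℂ} {z : OnePoint ℂ} {k : ℂ}
    (hz : IsEigenpoint S z k) :
    RatFunc.C k * (RatFunc.C (homY z) * mobiusFun S - RatFunc.C (homX z)) =
      RatFunc.C (S 0 0 * S 1 1 - S 0 1 * S 1 0) *
        (RatFunc.C (homY z) * RatFunc.X - RatFunc.C (homX z)) /
          (RatFunc.C (S 1 0) * RatFunc.X + RatFunc.C (S 1 1)) := by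
  have h0 := mobiusFun_denom_ne_zero S
  have h1 := congrArg (RatFunc.C (K := ℂ)) hz.1
  have h2 := congrArg (RatFunc.C (K := ℂ)) hz.2
  simp only [map_mul, map_add] at h1 h2
  have hm : mobiusFun S * (RatFunc.C (S 1 0) * RatFunc.X + RatFunc.C (S 1 1))
      = RatFunc.C (S 0 0) * RatFunc.X + RatFunc.C (S 0 1) := div_mul_cancel₀ _ h0
  rw [eq_div_iff h0]
  simp only [map_sub, map_mul]
  linear_combination RatFunc.C k * RatFunc.C (homY z) * hm +
    (RatFunc.C (S 1 0) * RatFunc.X + RatFunc.C (S 1 1)) * h1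
      - (RatFunc.C (S 0 0) * RatFunc.X + RatFunc.C (S 0 1)) * h2

/-- The involution changes the sign of the coordinate `u`. -/
theorem map_fixCoord {S : GL (Fin 2) ℂ} {α β : OnePoint ℂ} {k : ℂ}
    (hα : IsEigenpoint S α k) (hβ : IsEigenpoint S β (-k)) (φ : RatFunc ℂ →ₐ[ℂ] RatFunc ℂ)
    (hφ : ∀ F, φ F = compMobius F S) : φ (fixCoord α β) = -fixCoord α β := by
  have hX : φ RatFunc.X = mobiusFun S := by rw [hφ, compMobius, RatFunc.eval_X]
  have hC (c : ℂ) : φ (RatFunc.C c) = RatFunc.C c := φ.commutes c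
  have hlin : ∀ {z : OnePoint ℂ} {m : ℂ}, IsEigenpoint S z m →
      RatFunc.C m * φ (linFactor z) * (RatFunc.C (S 1 0) * RatFunc.X + RatFunc.C (S 1 1)) =
        RatFunc.C (S 0 0 * S 1 1 - S 0 1 * S 1 0) * linFactor z := by
    intro z m hz
    have h := compMobius_homogeneous hz
    rw [eq_div_iff (mobiusFun_denom_ne_zero S)] at h
    obtain ⟨ε, -, e⟩ := linFactor_eq z
    rw [e]
    simp only [map_mul, map_sub, hC, hX] at h ⊢
    linear_combination RatFunc.C ε * h
  have hd := ratFunc_C_ne_zero (det_ne_zero S)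
  have h1 := hlin hα
  have h2 := hlin hβ
  have hβ0 := linFactor_ne_zero β
  have hφβ : φ (linFactor β) ≠ 0 := by simpa using hβ0
  rw [fixCoord, map_div₀, ← neg_div, div_eq_div_iff hφβ hβ0]
  rw [map_neg] at h2
  apply mul_left_cancel₀ hd
  linear_combination (-φ (linFactor β)) * h1 - φ (linFactor α) * h2

/-- `ℂ(t) = ℂ(u)`. -/
theorem adjoin_fixCoord {α β : OnePoint ℂ} (hαβ : α ≠ β) : adjoin ℂ {fixCoord α β} = ⊤ := by
  rw [eq_top_iff, ← RatFunc.adjoin_X, adjoin_simple_le_iff]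
  have hu := mem_adjoin_simple_self ℂ (fixCoord α β)
  have hC (c : ℂ) : RatFunc.C c ∈ adjoin ℂ {fixCoord α β} := IntermediateField.algebraMap_mem _ c
  have hβ0 := linFactor_ne_zero β
  obtain ⟨ε, hε, e1⟩ := linFactor_eq α
  obtain ⟨δ, hδ, e2⟩ := linFactor_eq β
  have hε0 : ε ≠ 0 := by rintro rfl; simp at hε
  have hδ0 : δ ≠ 0 := by rintro rfl; simp at hδ
  have huβ : fixCoord α β * linFactor β = linFactor α := by
    rw [fixCoord, div_mul_cancel₀ _ hβ0]
  rw [e1, e2] at huβ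
  have h : (fixCoord α β * RatFunc.C δ * RatFunc.C (homY β) - RatFunc.C ε * RatFunc.C (homY α))
      * RatFunc.X = fixCoord α β * RatFunc.C δ * RatFunc.C (homX β)
        - RatFunc.C ε * RatFunc.C (homX α) := by
    linear_combination huβ
  -- If this coefficient of t vanished, so would the right-hand side of `h`; eliminating u between
  -- the two gives a zero determinant of α and β.
  have h0 : fixCoord α β * RatFunc.C δ * RatFunc.C (homY β) - RatFunc.C ε * RatFunc.C (homY α)
      ≠ 0 := by
    intro h0
    rw [h0, zero_mul] at h
    have h1 : RatFunc.C (ε * bracket α β) = 0 := by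
      simp only [bracket, map_mul, map_sub]
      linear_combination RatFunc.C (homY β) * h + RatFunc.C (homX β) * h0
    rw [map_eq_zero, mul_eq_zero, bracket_eq_zero_iff] at h1
    exact h1.elim hε0 hαβ
  have hX := eq_div_of_mul_eq h0 ((mul_comm _ _).trans h)
  rw [hX]
  exact div_mem (sub_mem (mul_mem (mul_mem hu (hC δ)) (hC _)) (mul_mem (hC ε) (hC _)))
    (sub_mem (mul_mem (mul_mem hu (hC δ)) (hC _)) (mul_mem (hC ε) (hC _)))

/-- The sums a + bu are closed under inversion by multiplying with the conjugate a - bu. -/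
theorem exists_even_odd_parts {K L : Type*} [Field K] [Field L] [CharZero L] [Algebra K L] {u F : L}
    (hF : F ∈ adjoin K {u}) :
    ∃ a ∈ adjoin K {u ^ 2}, ∃ b ∈ adjoin K {u ^ 2}, F = a + b * u := by
  have hu2 : u ^ 2 ∈ adjoin K {u ^ 2} := mem_adjoin_simple_self K _
  induction hF using adjoin_induction with
  | mem y hy =>
    rw [Set.mem_singleton_iff] at hy
    exact ⟨0, zero_mem _, 1, one_mem _, by rw [hy]; ring⟩
  | algebraMap c => exact ⟨_, IntermediateField.algebraMap_mem _ c, 0, zero_mem _, by ring⟩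
  | add y z _ _ hy hz =>
    obtain ⟨a, ha, b, hb, rfl⟩ := hy
    obtain ⟨c, hc, d, hd, rfl⟩ := hz
    exact ⟨a + c, add_mem ha hc, b + d, add_mem hb hd, by ring⟩
  | inv y _ hy =>
    obtain ⟨a, ha, b, hb, rfl⟩ := hy
    by_cases h0 : a + b * u = 0
    · exact ⟨0, zero_mem _, 0, zero_mem _, by simp [h0]⟩
    -- Possible when u itself lies in K(u²): the conjugate is useless, but the element is 2bu.
    by_cases h1 : a - b * u = 0
    · refine ⟨0, zero_mem _, (2 * b * u ^ 2)⁻¹,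
        inv_mem (mul_mem (mul_mem (ofNat_mem _ 2) hb) hu2), ?_⟩
      have h2 : a = b * u := by linear_combination h1
      have hbu : b * u ≠ 0 := fun h => h0 (by rw [h2, h, add_zero])
      have hb0 := left_ne_zero_of_mul hbu
      have hu0 := right_ne_zero_of_mul hbu
      rw [h2]
      field_simp
      ring
    · have hn : a ^ 2 - b ^ 2 * u ^ 2 ≠ 0 := by
        have := mul_ne_zero h0 h1
        convert this using 1
        ring
      have hnm : a ^ 2 - b ^ 2 * u ^ 2 ∈ adjoin K {u ^ 2} :=
        sub_mem (pow_mem ha 2) (mul_mem (pow_mem hb 2) hu2)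
      refine ⟨a / (a ^ 2 - b ^ 2 * u ^ 2), div_mem ha hnm, -b / (a ^ 2 - b ^ 2 * u ^ 2),
        div_mem (neg_mem hb) hnm, ?_⟩
      field_simp
      ring
  | mul y z _ _ hy hz =>
    obtain ⟨a, ha, b, hb, rfl⟩ := hy
    obtain ⟨c, hc, d, hd, rfl⟩ := hz
    exact ⟨a * c + b * d * u ^ 2, add_mem (mul_mem ha hc) (mul_mem (mul_mem hb hd) hu2),
      a * d + b * c, add_mem (mul_mem ha hd) (mul_mem hb hc), by ring⟩

theorem exists_eval_eq_of_mem_adjoin {K : Type} [Field K] [Algebra ℂ K] {x g : K}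
    (hg : g ∈ adjoin ℂ {x}) : ∃ G : RatFunc ℂ, g = RatFunc.eval (algebraMap ℂ K) x G := by
  obtain ⟨p, q, rfl⟩ := (mem_adjoin_simple_iff ℂ g).1 hg
  by_cases hq : Polynomial.aeval x q = 0
  · exact ⟨0, by simp [hq]⟩
  have hq0 : q ≠ 0 := by
    rintro rfl
    simp at hq
  set G : RatFunc ℂ := algebraMap ℂ[X] (RatFunc ℂ) p / algebraMap ℂ[X] (RatFunc ℂ) q with hG
  -- `RatFunc.eval` uses the reduced fraction; its denominator divides q and so does not vanish at x
  -- either.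
  have hd : Polynomial.aeval x G.denom ≠ 0 := by
    obtain ⟨r, hr⟩ := RatFunc.denom_div_dvd p q
    intro h
    apply hq
    rw [hr, map_mul, h, zero_mul]
  have h2 : G.num * q = p * G.denom := (RatFunc.num_mul_eq_mul_denom_iff hq0).2 hG
  refine ⟨G, ?_⟩
  change _ = Polynomial.aeval x G.num / Polynomial.aeval x G.denom
  rw [div_eq_div_iff hq hd, ← map_mul, ← map_mul, h2]

theorem deriv_sq {K : Type*} [Field K] [Differential K] (a : K) : (a ^ 2)′ = 2 * a * a′ := by
  rw [pow_two, Derivation.leibniz, smul_eq_mul]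
  ring

/-- A rational function that is odd for the involution is `u` times a rational function
of `u ^ 2`. -/
theorem exists_eq_eval_mul_fixCoord {S : GL (Fin 2) ℂ} (hS : IsMobiusInvolution S)
    {α β : OnePoint ℂ} (hαβ : α ≠ β) (hα : S • α = α) (hβ : S • β = β) {F : RatFunc ℂ}
    (hF : F + compMobius F S = 0) :
    ∃ b ∈ adjoin ℂ {fixCoord α β ^ 2}, F = b * fixCoord α β := by
  obtain ⟨k, -, hαk, hβk⟩ := hS.exists_eigenvalue hαβ hα hβ
  obtain ⟨φ, hφ⟩ := exists_compMobius_algHom S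
  have hu := map_fixCoord hαk hβk φ hφ
  have hfix : ∀ a ∈ adjoin ℂ {fixCoord α β ^ 2}, φ a = a := by
    intro a ha
    induction ha using adjoin_induction with
    | mem y hy =>
      rw [Set.mem_singleton_iff] at hy
      rw [hy, map_pow, hu, neg_sq]
    | algebraMap c => exact φ.commutes c
    | add y z _ _ hy hz => rw [map_add, hy, hz]
    | inv y _ hy => rw [map_inv₀, hy]
    | mul y z _ _ hy hz => rw [map_mul, hy, hz]
  have : CharZero (RatFunc ℂ) := charZero_of_injective_algebraMap (algebraMap ℂ _).injective
  obtain ⟨a, ha, b, hb, rfl⟩ := exists_even_odd_parts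
    (show F ∈ adjoin ℂ {fixCoord α β} by rw [adjoin_fixCoord hαβ]; trivial)
  refine ⟨b, hb, ?_⟩
  rw [← hφ, map_add, map_mul, hu, hfix a ha, hfix b hb] at hF
  -- The substitution fixes a and b and negates u, so F + F(S(t)) = 2a.
  have ha0 : a = 0 := by
    have h2 : (2 : RatFunc ℂ) * a = 0 := by linear_combination hF
    exact (mul_eq_zero.1 h2).resolve_left two_ne_zero
  rw [ha0, zero_add]

end Goursat

end

/-! ### The reduction theorem -/

open Goursat in
theorem theorem3p3 (R : ℂ[X]) (hdeg : R.natDegree = 3 ∨ R.natDegree = 4) (hR : R.Separable)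
    (S : GL (Fin 2) ℂ) (hS : IsMobiusInvolution S) (hSR : PermutesInPairs S R)
    (F : RatFunc ℂ) (hF : F + compMobius F S = 0) :
    IsPseudoElliptic R F ∧
    (∃ α β : OnePoint ℂ, α ≠ β ∧ {z : OnePoint ℂ | S • z = z} = {α, β}) ∧
    ∀ α β : OnePoint ℂ, α ≠ β → {z : OnePoint ℂ | S • z = z} = {α, β} →
      ∃ (G : RatFunc ℂ) (Q : ℂ[X]), Q.natDegree = 2 ∧ Q.Separable ∧
        -- `∫ F(t) dt / √(R(t)) = ∫ G(x) dx / (2 √(Q(x)))` under the substitution `x = u ^ 2`: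
        -- the integrands agree in `ℂ(t, √R)`, where `η` is the square root of `Q(x)`
        (∃ x η : SqrtField R,
          x = algebraMap (RatFunc ℂ) (SqrtField R) (fixCoord α β ^ 2) ∧
          η ^ 2 = Q.eval₂ (algebraMap ℂ (SqrtField R)) x ∧
          algebraMap (RatFunc ℂ) (SqrtField R) F / sqrtOf R
            = RatFunc.eval (algebraMap ℂ (SqrtField R)) x G * x′ / (2 * η)) ∧
        -- `∫ G(x) dx / (2 √(Q(x)))` is elementary
        HasElementaryIntegral (algebraMap (RatFunc ℂ) (SqrtField Q) G / (2 * sqrtOf Q)) := by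
  have hmain : ∀ α β : OnePoint ℂ, α ≠ β → {z : OnePoint ℂ | S • z = z} = {α, β} →
      ∃ (G : RatFunc ℂ) (Q : ℂ[X]), Q.natDegree = 2 ∧ Q.Separable ∧
        (∃ x η : SqrtField R,
          x = algebraMap (RatFunc ℂ) (SqrtField R) (fixCoord α β ^ 2) ∧
          η ^ 2 = Q.eval₂ (algebraMap ℂ (SqrtField R)) x ∧
          algebraMap (RatFunc ℂ) (SqrtField R) F / sqrtOf R
            = RatFunc.eval (algebraMap ℂ (SqrtField R)) x G * x′ / (2 * η)) ∧
        HasElementaryIntegral (algebraMap (RatFunc ℂ) (SqrtField Q) G / (2 * sqrtOf Q)) := by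
    intro α β hαβ hfix
    have hα : S • α = α := by
      have : α ∈ {z : OnePoint ℂ | S • z = z} := by simp [hfix]
      exact this
    have hβ : S • β = β := by
      have : β ∈ {z : OnePoint ℂ | S • z = z} := by simp [hfix]
      exact this
    obtain ⟨Q, hQ2, hQs, hQ⟩ := exists_quadratic hdeg hR hS hSR hαβ hα hβ
    obtain ⟨b, hb, hFb⟩ := exists_eq_eval_mul_fixCoord hS hαβ hα hβ hF
    have hbR : algebraMap (RatFunc ℂ) (SqrtField R) b ∈ IntermediateField.adjoin ℂ
        {algebraMap (RatFunc ℂ) (SqrtField R) (fixCoord α β ^ 2)} := by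
      obtain ⟨p, q, rfl⟩ := (IntermediateField.mem_adjoin_simple_iff ℂ b).1 hb
      refine (IntermediateField.mem_adjoin_simple_iff ℂ _).2 ⟨p, q, ?_⟩
      rw [map_div₀, Polynomial.aeval_algebraMap_apply, Polynomial.aeval_algebraMap_apply]
    obtain ⟨G, hG⟩ := exists_eval_eq_of_mem_adjoin hbR
    -- The suitable root is η = u'√R, since u'² R = Q(u²). Then G x'/(2η) = b · 2uu'/(2u'√R) = F/√R.
    refine ⟨G, Q, hQ2, hQs, ⟨_, algebraMap (RatFunc ℂ) (SqrtField R) (fixCoord α β)′ * sqrtOf R,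
      rfl, ?_, ?_⟩, ?_⟩
    · rw [mul_pow, sqrtOf_sq, ← map_pow, ← map_mul, hQ, ← Polynomial.aeval_algebraMap_apply]
      rfl
    · obtain ⟨e, he, hder⟩ := exists_deriv_fixCoord hαβ
      have hu' : (fixCoord α β)′ ≠ 0 := by
        intro h
        rw [h, zero_mul] at hder
        exact ratFunc_C_ne_zero he hder.symm
      have hu'' : algebraMap (RatFunc ℂ) (SqrtField R) (fixCoord α β)′ ≠ 0 := by simpa using hu'
      rw [← hG, deriv_algebraMap, deriv_sq, hFb]
      simp only [map_mul, map_ofNat]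
      have hR0 : sqrtOf R ≠ 0 := by
        intro h
        have h2 := sqrtOf_sq R
        rw [h, zero_pow two_ne_zero, eq_comm, map_eq_zero] at h2
        exact RatFunc.algebraMap_ne_zero hR.ne_zero h2
      field_simp
    · apply hasElementaryIntegral_of_mem_liouvilleSpan (deriv_algebraMap_complex Q)
      have hX : (algebraMap (RatFunc ℂ) (SqrtField Q) RatFunc.X)′ = 1 := by
        rw [deriv_algebraMap, deriv_X, map_one]
      have h := sqrt_quadratic_mem_liouvilleSpan (deriv_algebraMap_complex Q) hQ2 hQs
        (x := algebraMap (RatFunc ℂ) (SqrtField Q) RatFunc.X) (η := sqrtOf Q) (by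
          rw [sqrtOf_sq, ← RatFunc.aeval_X_left_eq_algebraMap,
            ← Polynomial.aeval_algebraMap_apply]
          rfl) G
      have hGX : RatFunc.eval (algebraMap ℂ (SqrtField Q))
          (algebraMap (RatFunc ℂ) (SqrtField Q) RatFunc.X) G
          = algebraMap (RatFunc ℂ) (SqrtField Q) G := by
        rw [RatFunc.eval, ← Polynomial.aeval_def, ← Polynomial.aeval_def,
          Polynomial.aeval_algebraMap_apply, Polynomial.aeval_algebraMap_apply, ← map_div₀,
          RatFunc.aeval_X_left_eq_algebraMap, RatFunc.aeval_X_left_eq_algebraMap,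
          RatFunc.num_div_denom]
      rwa [hX, mul_one, hGX] at h
  refine ⟨?_, hS.exists_fixedPoints, hmain⟩
  obtain ⟨α, β, hαβ, hfix⟩ := hS.exists_fixedPoints
  obtain ⟨G, Q, hQ2, hQs, ⟨x, η, -, hη, h⟩, -⟩ := hmain α β hαβ hfix
  -- Here x and η lie in ℂ(t, √R), so the rationalization of the conic takes place inside this
  -- field.
  apply hasElementaryIntegral_of_mem_liouvilleSpan (deriv_algebraMap_complex R)
  rw [h]
  exact sqrt_quadratic_mem_liouvilleSpan (deriv_algebraMap_complex R) hQ2 hQs hη G
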